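/- **Setting.** Let $n>1$, let $\varepsilon_1,\dots,\varepsilon_n$ be the standard basis vectors, $\Delta=\{\varepsilon_r-\varepsilon_s: r\ne s\in[1,n]\}$, $\alpha_i=\varepsilon_i-\varepsilon_{i+1}$ and $\pi=\{\alpha_1,\dots,\alpha_{n-1}\}$. Let $\mathscr J^+,\mathscr J^-$ be two partitions of $[1,n]$ into intervals and let $\pi^\pm$ be the set of $\alpha_i$ such that $i,i+1$ lie in the same part of $\mathscr J^\pm$. Assume $\pi^+\cup\pi^-=\pi$ and $\pi^+\cap\pi^-\neq\pi$. Put $R=(\mathbb N\pi^+\cup-\mathbb N\pi^-)\cap\Delta$ and $K=\Delta\setminus R$; a root is called nil if it lies in $K\cup -K$. **Markings.** For each part $[p,q]$ of $\mathscr J^+$ (resp. $\mathscr J^-$) draw above (resp. below) a horizontal line the half-integer arcs joining $i+\frac12$ and $j+\frac12$ for $p\le i\le j<q$, $i+j+1=p+q$. On the set of half-integer points $\frac32,\dots,n-\frac12$ these arcs decompose into connected components. Mark exactly one arc of each component; if the component contains an arc joining a point to itself (above or below), the marked arc must be such an arc. Marking the half-integer arc from $i+\frac12$ to $j+\frac12$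 marks the integer arc from $i$ to $j+1$ on the same side. **Modified involutions.** Let $[p,q]$ be a part of $\mathscr J^\pm$, $\kappa(i)=p+q-i$ on $[p,q]$ (and the identity elsewhere), and let $\mathscr M\subset[p,q]$ be the set of left ends of its marked integer arcs. For a connected component $[u,v]$ of $\mathscr M$ put $v^-=v$ if $2v+1=p+q$ and $v^-=v+1$ otherwise, and $\mathscr M_{u,v}=[u,v^-]\cup\kappa([u,v^-])$. Let $\sigma^\pm$ be any involution of $[1,n]$ which, on each part, equals $\kappa$ outside the sets $\mathscr M_{u,v}$, and restricts to each $\mathscr M_{u,v}$ as an anti-Toeplitz involution: it stabilizes $\mathscr M_{u,v}$; $\mathscr M_{u,v}$ is a single orbit of $\langle\kappa,\sigma^\pm\rangle$, which is a loop if $2v+2<p+q$ and an edge otherwise; and every two-element orbit of $\sigma^\pm$ in $\mathscr M_{u,v}$ has one point in $[u,v^-]$ and the other in $\kappa([u,v^-])$. Here an orbit of the group generated by two involutions $f,g$ is called an edge if it is also an orbit of $\langle fg\rangle$, and a loop otherwise. Let $S$ consist of the roots $\varepsilon_i-\varepsilon_{\sigma^+(i)}$ with $i<\sigma^+(i)$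 and $\varepsilon_i-\varepsilon_{\sigma^-(i)}$ with $i>\sigma^-(i)$. **An edge.** Let $E$ be a non-trivial edge of $\langle\sigma^+,\sigma^-\rangle$ (that is $e:=|E|>1$), with a chosen starting point $a\in E$ fixed by $\sigma^+$ or $\sigma^-$. Let $\varphi(1)=a,\varphi(2),\dots,\varphi(e)$ be the enumeration of $E$ obtained by applying $\sigma^-,\sigma^+,\sigma^-,\dots$ successively if $\sigma^+(a)=a$, and $\sigma^+,\sigma^-,\sigma^+,\dots$ otherwise. Put $\beta_i=\varepsilon_{\varphi(i)}-\varepsilon_{\varphi(i+1)}$ for $1\le i\le e-1$, and let $\epsilon_i\in\{\pm1\}$ be the sign with $\epsilon_i\beta_i\in S$. Let $S_E$ be the set of elements $\varepsilon_u-\varepsilon_v$ of $S$ with $u,v\in E$. The points $\varphi(1),\varphi(e)$ and the internal turning points, i.e. the $\varphi(t)$ with $1<t<e$ and $\varphi(t)$ strictly between $\varphi(t-1)$ and $\varphi(t+1)$, are the turning points. A turning point $\varphi(t)$ is a source (type $A$) if $\epsilon_t=1$ (when $t<e$) and $\epsilon_{t-1}=-1$ (when $t>1$), and a sink (type $B$)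 if $\epsilon_t=-1$ (when $t<e$) and $\epsilon_{t-1}=1$ (when $t>1$). **Signatures and external arcs.** To each internal turning point $\varphi(t)$ assign a signature $sg(t)\in\{\pm1\}$ such that $sg(t)=1$ if $\beta_t$ is nil, $sg(t)=-1$ if $\beta_{t-1}$ is nil and $\beta_t$ is not, and $sg(t)$ is arbitrary if neither is nil. ($\beta_{t-1}$ is marked and assigned to $\varphi(t)$ if $sg(t)=1$, and $\beta_t$ if $sg(t)=-1$.) * If $sg(t)=-1$, let $r<t$ be maximal such that $\varphi(r)$ is an internal turning point of the same type as $\varphi(t)$ with $sg(r)=-1$, let $s>r$ be minimal such that $\varphi(s)$ is a turning point of the opposite type (if no such $r$ exists, let $s\ge1$ be minimal such), and put $\beta^*_t=\epsilon_t\bigl(\beta_t+\sum_{k=s}^{t-1}\beta_k\bigr)$. * If $sg(t)=1$, let $s>t$ be minimal such that $\varphi(s)$ is a turning point of the opposite type, and put $\beta^*_{t-1}=\epsilon_{t-1}\bigl(\beta_{t-1}+\sum_{k=t}^{s-1}\beta_k\bigr)$. * For all other $i\in[1,e-1]$ put $\beta^*_i=\epsilon_i\beta_i$. **Proposition.** For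 all choices as above, $S_E=\{\epsilon_i\beta_i:1\le i\le e-1\}$, and $\Pi^*=\{\beta^*_i:1\le i\le e-1\}$ is a simple root system of type $A_{e-1}$, namely a system of simple roots of $\{\varepsilon_u-\varepsilon_v:u\neq v\in E\}$ with $e-1$ elements and Cartan matrix of type $A_{e-1}$, such that a) $\epsilon_i\beta_i\in\mathbb N\Pi^*$ for all $i\in[1,e-1]$; b) if $\beta^*_i\neq\epsilon_i\beta_i$, then $\beta^*_i\in K$. -/

import Mathlib

namespace Straightening

noncomputable section

/-! ### Roots of `sl_n`

Points of the line `L` are the natural numbers `1, …, n`; weights are integer vectors `ℕ → ℤ` in the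
usual coordinates, so that `ε_i` is the `i`-th basis vector. Of the two sides of `L`, `true` is the
upper one (superscript `+`) and `false` the lower one (superscript `-`). -/

/-- The weight `ε_r - ε_s`; a root when `r ≠ s`, drawn as an arrow from `r` to `s`. -/
def root (r s : ℕ) : ℕ → ℤ := Pi.single r 1 - Pi.single s 1

/-- The simple root `α_i = ε_i - ε_{i+1}`, located at the half-integer point `i + 1/2`. -/
def simpleRoot (i : ℕ) : ℕ → ℤ := root i (i + 1)

/-- The roots `ε_u - ε_v` with `u ≠ v` in `X`; for `X` of cardinality `e` this is a root system
of type `A_{e-1}`. -/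
def rootsOn (X : Set ℕ) : Set (ℕ → ℤ) := {γ | ∃ u ∈ X, ∃ v ∈ X, u ≠ v ∧ γ = root u v}

/-- The root system `Δ` of `sl_n`. -/
def Delta (n : ℕ) : Set (ℕ → ℤ) := rootsOn (Set.Icc 1 n)

/-- The standard scalar product on weights of `sl_n`. -/
def scalar (n : ℕ) (γ δ : ℕ → ℤ) : ℤ := ∑ i ∈ Finset.Icc 1 n, γ i * δ i

/-- `ℕ Π`: the sums of elements of `Π`. -/
def natSpan (Pi : Set (ℕ → ℤ)) : Set (ℕ → ℤ) := AddSubmonoid.closure Pi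

/-- `Π` is a system of simple roots of the set of roots `Φ`. -/
structure IsSimpleSystem (Φ Pi : Set (ℕ → ℤ)) : Prop where
  subset : Pi ⊆ Φ
  linearIndependent : LinearIndependent ℤ (Subtype.val : Pi → ℕ → ℤ)
  pos_or_neg : ∀ γ ∈ Φ, γ ∈ natSpan Pi ∨ -γ ∈ natSpan Pi

/-- `Π` has `m` elements and its Cartan matrix, for a suitable enumeration, is that of type `A_m`.
All roots have square length `2`, so Cartan integers are scalar products. -/
def IsOfTypeA (n m : ℕ) (Pi : Set (ℕ → ℤ)) : Prop :=
  ∃ b : Fin m ≃ Pi, ∀ j k, scalar n (b j) (b k) = CartanMatrix.A m j k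

/-! ### Partitions of `[1, n]` and the biparabolic -/

/-- All parts of the partition are connected, i.e. intervals. -/
def IsConnectedPartition {n : ℕ} (P : Finpartition (Finset.Icc 1 n)) : Prop :=
  ∀ B ∈ P.parts, ∃ p q, B = Finset.Icc p q

/-- The indices `i` of the simple roots `α_i` joining two neighbours of the same part. -/
def simpleIndices {n : ℕ} (P : Finpartition (Finset.Icc 1 n)) : Set ℕ :=
  {i | ∃ B ∈ P.parts, i ∈ B ∧ i + 1 ∈ B}

/-- `R = (ℕ π⁺ ∪ -ℕ π⁻) ∩ Δ`. -/
def rootsR {n : ℕ} (J : Bool → Finpartition (Finset.Icc 1 n)) : Set (ℕ → ℤ) :=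
  {γ | γ ∈ Delta n ∧ (γ ∈ natSpan (simpleRoot '' simpleIndices (J true)) ∨
    -γ ∈ natSpan (simpleRoot '' simpleIndices (J false)))}

/-- `K = Δ \ R`. -/
def rootsK {n : ℕ} (J : Bool → Finpartition (Finset.Icc 1 n)) : Set (ℕ → ℤ) :=
  Delta n \ rootsR J

/-- A root is nil if it lies in `K ∪ -K`. -/
def IsNil {n : ℕ} (J : Bool → Finpartition (Finset.Icc 1 n)) (γ : ℕ → ℤ) : Prop :=
  γ ∈ rootsK J ∨ -γ ∈ rootsK J

/-! ### Meanders -/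

/-- A meander of two involutions is an orbit of the group they generate. -/
def IsMeander (f g : Equiv.Perm ℕ) (E : Set ℕ) : Prop :=
  ∃ x, E = MulAction.orbit (Subgroup.closure {f, g}) x

/-- An edge is a meander which is also an orbit of the group generated by the product. -/
def IsEdge (f g : Equiv.Perm ℕ) (E : Set ℕ) : Prop :=
  IsMeander f g E ∧ ∃ x, E = MulAction.orbit (Subgroup.zpowers (f * g)) x

/-- A loop is a meander which is not an edge. -/
def IsLoop (f g : Equiv.Perm ℕ) (E : Set ℕ) : Prop := IsMeander f g E ∧ ¬ IsEdge f g E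

/-! ### Half-integer arcs and their markings -/

/-- The half-integer arc joining `i + 1/2` and `j + 1/2`, `i ≤ j`, belongs to the link pattern which
reverses the simple roots `α_p, …, α_{q-1}` of every part `[p, q]`. -/
def IsHalfArc {n : ℕ} (P : Finpartition (Finset.Icc 1 n)) (i j : ℕ) : Prop :=
  ∃ p q, Finset.Icc p q ∈ P.parts ∧ p ≤ i ∧ i ≤ j ∧ i + j + 1 = p + q

/-- `i + 1/2` and `j + 1/2` lie on the same half-integer meander. (Fictitious arcs only join the two
free ends of one chain of genuine arcs to each other, possibly through an added fictitious point, or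
a free end to itself if the other end of its chain is a genuine fixed point; so they do not change
which points of `π` share a meander.) -/
def SameHalfMeander {n : ℕ} (J : Bool → Finpartition (Finset.Icc 1 n)) : ℕ → ℕ → Prop :=
  Relation.EqvGen fun i j => ∃ b, IsHalfArc (J b) i j

/-- The half-integer meander of `i + 1/2` is an edge: it contains a point which is fixed by one of
the two half-integer involutions. (A chain with a fictitious fixed point has a genuine one at its
other end.) -/
def HalfMeanderIsEdge {n : ℕ} (J : Bool → Finpartition (Finset.Icc 1 n)) (i : ℕ) : Prop :=
  ∃ j, SameHalfMeander J i j ∧ ∃ b, IsHalfArc (J b) j j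

/-- `M b` is the set of left ends `i` of the marked half-integer arcs on the side `b`. Exactly one
genuine (non-fictitious) arc is marked on every half-integer meander, and if the meander is an edge
then the marked arc is an end, that is joins a fixed point to itself. Marking the half-integer arc
from `i + 1/2` to `j + 1/2` is the same as marking the integer arc from `i` to `j + 1`. -/
structure IsMarking {n : ℕ} (J : Bool → Finpartition (Finset.Icc 1 n)) (M : Bool → Set ℕ) :
    Prop where
  isArc : ∀ b, ∀ i ∈ M b, ∃ j, IsHalfArc (J b) i j
  existsUnique : ∀ k ∈ Set.Ico 1 n, ∃! x : Bool × ℕ, x.2 ∈ M x.1 ∧ SameHalfMeander J k x.2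
  isEnd : ∀ b, ∀ i ∈ M b, HalfMeanderIsEdge J i → IsHalfArc (J b) i i

/-! ### Modified involutions -/

/-- The reflection `i ↦ p + q - i` of `[p, q]`, extended by the identity. -/
def reflectFun (p q i : ℕ) : ℕ := if p ≤ i ∧ i ≤ q then p + q - i else i

theorem reflectFun_involutive (p q : ℕ) : Function.Involutive (reflectFun p q) := by
  intro i
  unfold reflectFun
  split_ifs <;> omega

/-- The integer involution `κ_J` of `J = [p, q]`. -/
def kappa (p q : ℕ) : Equiv.Perm ℕ := (reflectFun_involutive p q).toPerm

/-- `[u, v]` is a connected component of the set of markings of the part `[p, q]`. -/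
def IsMarkComponent (M : Set ℕ) (p q u v : ℕ) : Prop :=
  p ≤ u ∧ u ≤ v ∧ v ≤ q ∧ (∀ i ∈ Set.Icc u v, i ∈ M) ∧ (p < u → u - 1 ∉ M) ∧ (v < q → v + 1 ∉ M)

/-- The left half of the extended component of `[u, v]`: it is `[u, v + 1]`, except that it is
`[u, v]` when `v` is adjacent to the non-integer centre of `[p, q]`. -/
def extLeft (p q u v : ℕ) : Set ℕ := Set.Icc u (if 2 * v + 1 = p + q then v else v + 1)

/-- The right half of the extended component. -/
def extRight (p q u v : ℕ) : Set ℕ := kappa p q '' extLeft p q u v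

/-- The extended component of `[u, v]`. -/
def extComponent (p q u v : ℕ) : Set ℕ := extLeft p q u v ∪ extRight p q u v

/-- `σ` restricts to an anti-Toeplitz involution of the extended component of `[u, v]`. The first
alternative in `meander` is the one where `v` is not the innermost arc of `[p, q]`. -/
structure IsAntiToeplitz (p q u v : ℕ) (σ : Equiv.Perm ℕ) : Prop where
  mapsTo : ∀ x ∈ extComponent p q u v, σ x ∈ extComponent p q u v
  meander : if 2 * v + 2 < p + q then IsLoop (kappa p q) σ (extComponent p q u v)
    else IsEdge (kappa p q) σ (extComponent p q u v)
  opposite : ∀ x ∈ extComponent p q u v, σ x ≠ x →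
    (x ∈ extLeft p q u v ∧ σ x ∈ extRight p q u v) ∨
      (x ∈ extRight p q u v ∧ σ x ∈ extLeft p q u v)

/-- `σ` is a modified involution for the partition `P` with the markings `M`: on every part it is
anti-Toeplitz on the extended components of the markings and the reflection elsewhere. -/
structure IsModifiedInvolution {n : ℕ} (P : Finpartition (Finset.Icc 1 n)) (M : Set ℕ)
    (σ : Equiv.Perm ℕ) : Prop where
  involutive : ∀ i, σ (σ i) = i
  outside : ∀ i, i ∉ Set.Icc 1 n → σ i = i
  unmodified : ∀ p q, Finset.Icc p q ∈ P.parts → ∀ i ∈ Set.Icc p q,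
    (∀ u v, IsMarkComponent M p q u v → i ∉ extComponent p q u v) → σ i = kappa p q i
  modified : ∀ p q, Finset.Icc p q ∈ P.parts → ∀ u v, IsMarkComponent M p q u v →
    IsAntiToeplitz p q u v σ

/-- `S = S⁺ ∪ S⁻`: arcs above the line point from left to right, arcs below from right to left. -/
def rootsS (σ : Bool → Equiv.Perm ℕ) : Set (ℕ → ℤ) :=
  {γ | ∃ i, i < σ true i ∧ γ = root i (σ true i)} ∪
    {γ | ∃ i, σ false i < i ∧ γ = root i (σ false i)}

/-- `S_E`: the elements of `S` given by arcs with both end-points in `E`. -/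
def rootsSOn (σ : Bool → Equiv.Perm ℕ) (E : Set ℕ) : Set (ℕ → ℤ) := rootsS σ ∩ rootsOn E

/-! ### Following an edge

`a` is the starting point and `e` the number of points of an edge. -/

/-- The side of the arc joining `φ(t)` to `φ(t + 1)`: the first one is below if `a` is fixed by
`σ⁺` and above otherwise, and sides alternate. -/
def stepSide (σ : Bool → Equiv.Perm ℕ) (a t : ℕ) : Bool :=
  if (σ true a = a ↔ Odd t) then false else true

/-- The enumeration `φ(1) = a, φ(2), …, φ(e)` of the edge (the value at `0` is irrelevant). -/
def phi (σ : Bool → Equiv.Perm ℕ) (a : ℕ) : ℕ → ℕ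
  | 0 => a
  | 1 => a
  | t + 2 => σ (stepSide σ a (t + 1)) (phi σ a (t + 1))

/-- `β_i = ε_{φ(i)} - ε_{φ(i+1)}`. -/
def beta (σ : Bool → Equiv.Perm ℕ) (a i : ℕ) : ℕ → ℤ := root (phi σ a i) (phi σ a (i + 1))

open Classical in
/-- The sign `ϵ_i` with `ϵ_i β_i ∈ S`. -/
def eps (σ : Bool → Equiv.Perm ℕ) (a i : ℕ) : ℤ := if beta σ a i ∈ rootsS σ then 1 else -1

/-- `ι_I = ∑ β_i` over the interval `I_{s,t} = [s, t - 1]`. -/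
def intervalValue (σ : Bool → Equiv.Perm ℕ) (a s t : ℕ) : ℕ → ℤ := ∑ i ∈ Finset.Ico s t, beta σ a i

/-- `φ(t)` is an internal turning point. -/
def IsInternalTurning (σ : Bool → Equiv.Perm ℕ) (a e t : ℕ) : Prop :=
  1 < t ∧ t < e ∧
    ((phi σ a (t - 1) < phi σ a t ∧ phi σ a t < phi σ a (t + 1)) ∨
      (phi σ a (t + 1) < phi σ a t ∧ phi σ a t < phi σ a (t - 1)))

/-- `φ(t)` is a turning point: an end-point or an internal turning point. -/
def IsTurning (σ : Bool → Equiv.Perm ℕ) (a e t : ℕ) : Prop :=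
  t = 1 ∨ t = e ∨ IsInternalTurning σ a e t

/-- The turning point `φ(t)` is a source (type `A`): the arrows of all arcs meeting it leave it. -/
def IsSource (σ : Bool → Equiv.Perm ℕ) (a e t : ℕ) : Prop :=
  IsTurning σ a e t ∧ (t < e → eps σ a t = 1) ∧ (1 < t → eps σ a (t - 1) = -1)

/-- The turning point `φ(t)` is a sink (type `B`): the arrows of all arcs meeting it enter it. -/
def IsSink (σ : Bool → Equiv.Perm ℕ) (a e t : ℕ) : Prop :=
  IsTurning σ a e t ∧ (t < e → eps σ a t = -1) ∧ (1 < t → eps σ a (t - 1) = 1)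

/-- `φ(s)` and `φ(t)` are turning points of the same type. -/
def SameType (σ : Bool → Equiv.Perm ℕ) (a e s t : ℕ) : Prop :=
  (IsSource σ a e s ∧ IsSource σ a e t) ∨ (IsSink σ a e s ∧ IsSink σ a e t)

/-- `φ(s)` and `φ(t)` are turning points of opposite types. -/
def OppositeType (σ : Bool → Equiv.Perm ℕ) (a e s t : ℕ) : Prop :=
  (IsSource σ a e s ∧ IsSink σ a e t) ∨ (IsSink σ a e s ∧ IsSource σ a e t)

/-! ### Signatures, external arcs and the new simple system -/

/-- At an internal turning point `φ(t)` the boundary value `β_{t-1}` is marked if `sg t = 1` and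
`β_t` is marked if `sg t = -1`. If exactly one of the two is nil, the other one is marked; if both
are nil, `β_{t-1}` is marked; if none is nil, the choice is free. -/
structure IsSignature {n : ℕ} (J : Bool → Finpartition (Finset.Icc 1 n))
    (σ : Bool → Equiv.Perm ℕ) (a e : ℕ) (sg : ℕ → ℤ) : Prop where
  sign : ∀ t, IsInternalTurning σ a e t → sg t = 1 ∨ sg t = -1
  both : ∀ t, IsInternalTurning σ a e t →
    IsNil J (beta σ a (t - 1)) → IsNil J (beta σ a t) → sg t = 1
  upper : ∀ t, IsInternalTurning σ a e t →
    IsNil J (beta σ a (t - 1)) → ¬ IsNil J (beta σ a t) → sg t = -1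
  lower : ∀ t, IsInternalTurning σ a e t →
    ¬ IsNil J (beta σ a (t - 1)) → IsNil J (beta σ a t) → sg t = 1

/-- The internal turning points of the same type as `φ(t)` and of negative signature which lie
strictly above `φ(t)` on the vertical line, that is have a smaller index. -/
def negativeAbove (σ : Bool → Equiv.Perm ℕ) (a e : ℕ) (sg : ℕ → ℤ) (t : ℕ) : Set ℕ :=
  {r | r < t ∧ IsInternalTurning σ a e r ∧ SameType σ a e r t ∧ sg r = -1}

open Classical in
/-- The index `s` of the turning point `φ(s)` crossed by the external arc assigned to an internal
turning point `φ(t)` of negative signature: the first turning point of the opposite type, going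
down, after the nearest member of `negativeAbove` if there is one, and on the whole edge
otherwise. -/
def crossedNeg (σ : Bool → Equiv.Perm ℕ) (a e : ℕ) (sg : ℕ → ℤ) (t : ℕ) : ℕ :=
  if (negativeAbove σ a e sg t).Nonempty then
    sInf {s | sSup (negativeAbove σ a e sg t) < s ∧ OppositeType σ a e s t}
  else sInf {s | OppositeType σ a e s t}

/-- The index `s` of the turning point `φ(s)` crossed by the external arc assigned to an internal
turning point `φ(t)` of positive signature: the first one of the opposite type below `φ(t)`. -/
def crossedPos (σ : Bool → Equiv.Perm ℕ) (a e t : ℕ) : ℕ :=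
  sInf {s | t < s ∧ OppositeType σ a e s t}

open Classical in
/-- `β*_i`: a marked value is replaced by the value of the external arc assigned to the same
turning point, and an unmarked one is kept, as `ϵ_i β_i`. -/
def betaStar (σ : Bool → Equiv.Perm ℕ) (a e : ℕ) (sg : ℕ → ℤ) (i : ℕ) : ℕ → ℤ :=
  if IsInternalTurning σ a e i ∧ sg i = -1 then
    eps σ a i • (beta σ a i + intervalValue σ a (crossedNeg σ a e sg i) i)
  else if IsInternalTurning σ a e (i + 1) ∧ sg (i + 1) = 1 then
    eps σ a i • (beta σ a i + intervalValue σ a (i + 1) (crossedPos σ a e (i + 1)))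
  else eps σ a i • beta σ a i

/-- `Π* = {β*_i : 1 ≤ i ≤ e - 1}`. -/
def PiStar (σ : Bool → Equiv.Perm ℕ) (a e : ℕ) (sg : ℕ → ℤ) : Set (ℕ → ℤ) :=
  betaStar σ a e sg '' Set.Ico 1 e

end

end Straightening

open Straightening

/-!
The new arcs are the links of a directed path through all the points of `E`. The path is found by
inserting `φ(1), φ(2), …` one after the other into the gap between two lists. The gap stays next to
the last point: ahead of it while the edge runs on in one direction, behind it after a turning point
of signature `1`. At a turning point of signature `-1` the two lists are joined, and the gap moves
to the far end of the path. The differences of consecutive entries of a duplicate-free list form a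
simple system of type `A`, and every old arc joins two entries in the order of the list, so it is a
sum of new arcs.

That external arcs have values in `K` comes from the order of the turning points in one part: in a
part of `𝒥⁺` sources are to the left of sinks, in a part of `𝒥⁻` to the right. For points moved by
the involution of that part this is visible from its centre. A point fixed by this involution is
the delicate case: all half-integer arcs of the part between the point and its reflection are then
marked, so they lie on distinct half-integer meanders, none of which is an edge, and the centre of
a part on the other side cannot fall in between.
-/

namespace Straightening

/-! ### Ordered pairs of entries of a list -/

section Lists

variable {α : Type*}

/-- The pairs of consecutive entries of a list, seen as a directed path. -/
def links (l : List α) : Set (α × α) := {p | [p.1, p.2] <:+: l}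

/-- The pairs of entries of a list which occur in this order. -/
def orderedPairs (l : List α) : Set (α × α) := {p | [p.1, p.2].Sublist l}

theorem links_nil : links ([] : List α) = ∅ := by simp [links]

theorem mem_links_iff_getElem {l : List α} {p : α × α} :
    p ∈ links l ↔ ∃ (k : ℕ) (hk : k + 1 < l.length), (l[k], l[k + 1]) = p := by
  simp only [links, Set.mem_ofPred_eq, List.infix_iff_getElem?, Prod.ext_iff]
  constructor
  · rintro ⟨k, hk, h⟩
    have h0 := h 0 (by simp)
    have h1 := h 1 (by simp)
    simp only [List.length_cons, List.length_nil] at hk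
    refine ⟨k, by omega, ?_, ?_⟩ <;> grind
  · rintro ⟨k, hk, h0, h1⟩
    refine ⟨k, by simp; omega, fun i hi => ?_⟩
    grind

theorem links_cons (x : α) (l : List α) :
    links (x :: l) = {p | p.1 = x ∧ l.head? = some p.2} ∪ links l := by
  ext p
  cases l <;> simp [links, List.infix_cons_iff, List.cons_prefix_cons, @eq_comm _ p.2]

theorem links_append (l₁ l₂ : List α) :
    links (l₁ ++ l₂) =
      links l₁ ∪ {p | l₁.getLast? = some p.1 ∧ l₂.head? = some p.2} ∪ links l₂ := by
  induction l₁ with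
  | nil => simp [links_nil]
  | cons x l ih =>
    rw [List.cons_append, links_cons, links_cons, ih]
    cases l with
    | nil => ext p; simp [links_nil, eq_comm]
    | cons y l => ext p; simp [or_assoc]

theorem links_append_cons (l₁ : List α) (x : α) (l₂ : List α) :
    links (l₁ ++ x :: l₂) = links (l₁ ++ [x]) ∪ links (x :: l₂) := by
  rw [links_append, links_append]
  simp [links_cons, links_nil]

theorem links_reverse (l : List α) : links l.reverse = Prod.swap '' links l := by
  rw [Set.image_swap_eq_preimage_swap]
  ext p
  simp [links, ← List.reverse_infix (l₂ := l)]

theorem links_map {α β : Type*} (f : α → β) (L : List α) :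
    links (L.map f) = Prod.map f f '' links L := by
  ext p
  simp only [mem_links_iff_getElem, Set.mem_image, List.length_map, List.getElem_map]
  constructor
  · rintro ⟨k, hk, rfl⟩
    exact ⟨_, ⟨k, hk, rfl⟩, rfl⟩
  · rintro ⟨_, ⟨k, hk, rfl⟩, rfl⟩
    exact ⟨k, hk, rfl⟩

theorem mem_orderedPairs_reverse {l : List α} {p : α × α} :
    p ∈ orderedPairs l.reverse ↔ p.swap ∈ orderedPairs l := by
  simp [orderedPairs, ← List.reverse_sublist (l₂ := l)]

theorem mem_orderedPairs_or_swap {l : List α} {x y : α} (hx : x ∈ l) (hy : y ∈ l) (hxy : x ≠ y) :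
    (x, y) ∈ orderedPairs l ∨ (y, x) ∈ orderedPairs l := by
  induction l with
  | nil => simp at hx
  | cons z l ih =>
    rcases List.mem_cons.1 hx with rfl | hx'
    · exact Or.inl (by simpa [orderedPairs, hxy.symm] using hy)
    · rcases List.mem_cons.1 hy with rfl | hy'
      · exact Or.inr (by simpa [orderedPairs] using hx')
      · exact (ih hx' hy').imp (·.cons z) (·.cons z)

/-- The pair `p`, reversed when `b` is false. -/
def orient (b : Bool) (p : α × α) : α × α := if b then p else p.swap

theorem orient_orient (b : Bool) (p : α × α) : orient b (orient b p) = p := by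
  cases b <;> simp [orient]

theorem swap_orient (b : Bool) (p : α × α) : (orient b p).swap = orient (!b) p := by
  cases b <;> simp [orient]

theorem orient_not_mk (b : Bool) (x y : α) : orient (!b) (x, y) = orient b (y, x) := by
  cases b <;> simp [orient]

end Lists

/-! ### Straightening a zigzag -/

section Zigzag

/-- The direction of the steps of the path `1, …, e` changes at the interior point `t`. The `i`-th
step joins `i` and `i + 1` and points forwards if `d i` is true, backwards otherwise. -/
def Turns (e : ℕ) (d : ℕ → Bool) (t : ℕ) : Prop := 1 < t ∧ t < e ∧ d (t - 1) ≠ d t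

/-- The type of a turning point or end-point `t` of a zigzag: it is a source (`b = true`) or a sink
(`b = false`). -/
def HasType (e : ℕ) (d : ℕ → Bool) (b : Bool) (t : ℕ) : Prop :=
  1 ≤ t ∧ t ≤ e ∧ (t < e → d t = b) ∧ (1 < t → d (t - 1) = !b)

/-- The points of type `b` beyond all turning points of the other type and of negative signature
before `m`; the set of turning points of negative signature is `N`. -/
def beyond (e : ℕ) (d : ℕ → Bool) (N : ℕ → Prop) (m : ℕ) (b : Bool) : Set ℕ :=
  {s | HasType e d b s ∧ ∀ r < m, Turns e d r → N r → d r = !b → r < s}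

/-- The points crossed by the external arcs of a zigzag: `cn t` for a turning point `t` of negative
signature, `cp t` for one of positive signature. The last condition says that no step is assigned to
both of its end-points. -/
structure IsCrossing (e : ℕ) (d : ℕ → Bool) (N : ℕ → Prop) (cn cp : ℕ → ℕ) : Prop where
  neg : ∀ t, Turns e d t → N t → IsLeast (beyond e d N t (!d t)) (cn t)
  pos : ∀ t, Turns e d t → ¬ N t → IsLeast {s | t < s ∧ HasType e d (!d t) s} (cp t)
  succ : ∀ t, Turns e d t → N t → Turns e d (t + 1) → N (t + 1)

/-- The `i`-th step of a zigzag as a directed arc. -/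
def oldArc (d : ℕ → Bool) (i : ℕ) : ℕ × ℕ := orient (d i) (i, i + 1)

open Classical in
/-- The `i`-th step after straightening the turning points: a step assigned to a turning point is
replaced by the external arc. -/
noncomputable def newArc (e : ℕ) (d : ℕ → Bool) (N : ℕ → Prop) (cn cp : ℕ → ℕ) (i : ℕ) : ℕ × ℕ :=
  if Turns e d i ∧ N i then orient (d i) (cn i, i + 1)
  else if Turns e d (i + 1) ∧ ¬ N (i + 1) then orient (d i) (i, cp (i + 1))
  else orient (d i) (i, i + 1)

open Classical in
/-- The end of the `m`-th new arc other than `m + 1`, if this step is not assigned to `m + 1`. -/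
noncomputable def slotPoint (e : ℕ) (d : ℕ → Bool) (N : ℕ → Prop) (cn : ℕ → ℕ) (m : ℕ) : ℕ :=
  if Turns e d m ∧ N m then cn m else m

/-- The `i`-th step is assigned to the last turning point up to `m`, so that the `i`-th new arc ends
at a point after `m`. -/
def IsPending (e : ℕ) (d : ℕ → Bool) (N : ℕ → Prop) (m i : ℕ) : Prop :=
  i + 1 ≤ m ∧ Turns e d (i + 1) ∧ ¬ N (i + 1) ∧ ∀ k ∈ Set.Icc (i + 1) m, d k = d m

/-- A partially straightened zigzag on `1, …, m`: in the direction of the `m`-th step, the new arcs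
found so far run through `F.reverse` and `B`, and `m + 1` has to be inserted between these lists. -/
structure IsSlotted (e : ℕ) (d : ℕ → Bool) (N : ℕ → Prop) (cn cp : ℕ → ℕ) (m : ℕ)
    (F B : List ℕ) : Prop where
  perm : (F.reverse ++ B).Perm (List.range' 1 m)
  self_mem : m ∈ F
  head_front : F.head? = some (slotPoint e d N cn m)
  head_back : ∀ i, B.head? = some i ↔ IsPending e d N m i
  last_front : ∀ s, F.getLast? = some s → IsLeast (beyond e d N (m + 1) (d m)) s
  last_back : ∀ s, B.getLast? = some s → IsLeast (beyond e d N (m + 1) (!d m)) s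
  back_nil : B = [] → ∀ s ∈ beyond e d N (m + 1) (!d m), m < s
  ordered : ∀ i ∈ Set.Ico 1 m, orient (d m) (oldArc d i) ∈ orderedPairs (F.reverse ++ B)
  links_eq : links F.reverse ∪ links B =
    orient (d m) '' (newArc e d N cn cp '' {i ∈ Set.Ico 1 m | ¬ IsPending e d N m i})

variable {e : ℕ} {d : ℕ → Bool} {N : ℕ → Prop} {cn cp : ℕ → ℕ}

theorem Turns.eq_not {m : ℕ} (h : Turns e d (m + 1)) : d (m + 1) = !d m :=
  Bool.eq_not.2 h.2.2.symm

theorem Turns.hasType {t : ℕ} (h : Turns e d t) : HasType e d (d t) t :=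
  ⟨h.1.le, h.2.1.le, fun _ => rfl, fun _ => Bool.eq_not.2 h.2.2⟩

theorem not_turns_one : ¬ Turns e d 1 := fun h => lt_irrefl _ h.1

theorem not_isPending_one (i : ℕ) : ¬ IsPending e d N 1 i := by
  rintro ⟨hi, ht, -⟩
  have := ht.1
  omega

theorem isPending_succ_of_eq {m i : ℕ} (hd : d (m + 1) = d m) :
    IsPending e d N (m + 1) i ↔ IsPending e d N m i := by
  constructor
  · rintro ⟨hi, ht, hN, hk⟩
    have him : i ≠ m := by rintro rfl; exact ht.2.2 hd.symm
    exact ⟨by omega, ht, hN, fun k hk' => (hk k ⟨hk'.1, by have := hk'.2; omega⟩).trans hd⟩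
  · rintro ⟨hi, ht, hN, hk⟩
    refine ⟨by omega, ht, hN, fun k hk' => ?_⟩
    rcases Nat.le_succ_iff.1 hk'.2 with hkm | rfl
    · exact (hk k ⟨hk'.1, hkm⟩).trans hd.symm
    · rfl

theorem isPending_succ_of_turns {m i : ℕ} (ht : Turns e d (m + 1)) :
    IsPending e d N (m + 1) i ↔ i = m ∧ ¬ N (m + 1) := by
  constructor
  · rintro ⟨hi, -, hN, hk⟩
    obtain rfl : i = m := by
      by_contra him
      exact ht.2.2 (hk m ⟨by omega, by omega⟩)
    exact ⟨rfl, hN⟩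
  · rintro ⟨rfl, hN⟩
    exact ⟨le_rfl, ht, hN, fun k hk => by rw [le_antisymm hk.2 hk.1]⟩

theorem beyond_succ {m : ℕ} {b : Bool} (h : Turns e d m → N m → d m = b) :
    beyond e d N (m + 1) b = beyond e d N m b := by
  ext s
  refine and_congr_right fun _ => ⟨fun hs r hr => hs r (by omega), fun hs r hr ht hN hd => ?_⟩
  rcases Nat.lt_succ_iff_lt_or_eq.1 hr with hr | rfl
  · exact hs r hr ht hN hd
  · simp [h ht hN] at hd

theorem newArc_eq_slotPoint {m : ℕ} (h : ¬ (Turns e d (m + 1) ∧ ¬ N (m + 1))) :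
    newArc e d N cn cp m = orient (d m) (slotPoint e d N cn m, m + 1) := by
  unfold newArc slotPoint
  split_ifs <;> rfl

theorem IsPending.cp_eq (hc : IsCrossing e d N cn cp) {m i : ℕ} (hi : IsPending e d N m i)
    (hty : HasType e d (!d m) (m + 1)) : cp (i + 1) = m + 1 := by
  obtain ⟨him, ht, hN, hk⟩ := hi
  have hdi : d (i + 1) = d m := hk _ ⟨le_rfl, him⟩
  refine (hc.pos _ ht hN).unique ⟨⟨by omega, by rwa [hdi]⟩, ?_⟩
  rintro s ⟨his, hs⟩
  by_contra hlt
  have hds : d s = !d (i + 1) := hs.2.2.1 (by have := hty.2.1; omega)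
  rw [hdi, hk s ⟨by omega, by omega⟩] at hds
  simp at hds

theorem IsPending.newArc_eq (hc : IsCrossing e d N cn cp) {m i : ℕ} (hi : IsPending e d N m i)
    (hty : HasType e d (!d m) (m + 1)) : newArc e d N cn cp i = orient (d m) (m + 1, i) := by
  have hcp := hi.cp_eq hc hty
  obtain ⟨him, ht, hN, hk⟩ := hi
  have hdi : d i = !d m := by
    rw [← hk _ ⟨le_rfl, him⟩, Bool.eq_not]
    exact ht.2.2
  unfold newArc
  rw [if_neg fun h => hN (hc.succ i h.1 h.2 ht), if_pos ⟨ht, hN⟩, hcp, hdi, orient_not_mk]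

theorem isSlotted_one (he : 1 < e) : IsSlotted e d N cn cp 1 [1] [] where
  perm := by simp
  self_mem := by simp
  head_front := by simp [slotPoint, not_turns_one]
  head_back i := by simp [not_isPending_one]
  last_front s hs := by
    obtain rfl : 1 = s := by simpa using hs
    refine ⟨⟨⟨le_rfl, he.le, fun _ => rfl, fun h => absurd h (lt_irrefl 1)⟩, fun r hr ht => ?_⟩,
      fun s hs => hs.1.1⟩
    have := ht.1
    omega
  last_back s hs := by simp at hs
  back_nil _ s hs := by
    refine lt_of_le_of_ne hs.1.1 ?_
    rintro rfl
    simpa using hs.1.2.2.1 he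
  ordered i hi := by simp at hi
  links_eq := by simp [links_cons, links_nil]

namespace IsSlotted

variable {F B : List ℕ} {m : ℕ} (h : IsSlotted e d N cn cp m F B)

include h

theorem front_ne_nil : F ≠ [] := List.ne_nil_of_mem h.self_mem

theorem one_le : 1 ≤ m := by
  have : m ∈ F.reverse ++ B := by simp [h.self_mem]
  simpa using (List.mem_range'_1.1 (h.perm.mem_iff.1 this)).1

theorem perm_insert : (F.reverse ++ (m + 1) :: B).Perm (List.range' 1 (m + 1)) := by
  rw [List.range'_1_concat, add_comm 1 m]
  exact List.perm_middle.trans ((h.perm.cons _).trans (List.perm_append_singleton _ _).symm)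

theorem ordered_insert {i : ℕ} (hi : i ∈ Set.Ico 1 (m + 1)) :
    orient (d m) (oldArc d i) ∈ orderedPairs (F.reverse ++ (m + 1) :: B) := by
  rcases Nat.lt_succ_iff_lt_or_eq.1 hi.2 with him | rfl
  · exact (h.ordered i ⟨hi.1, him⟩).trans ((List.sublist_cons_self _ _).append_left _)
  · have hF : [i].Sublist F.reverse := by simpa using h.self_mem
    rw [oldArc, orient_orient]
    exact hF.append (by simp : [i + 1].Sublist ((i + 1) :: B))

theorem links_insert_front (hd : ¬ (Turns e d (m + 1) ∧ ¬ N (m + 1))) :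
    links (F.reverse ++ [m + 1]) =
      links F.reverse ∪ {orient (d m) (newArc e d N cn cp m)} := by
  rw [links_append, newArc_eq_slotPoint hd, orient_orient, List.getLast?_reverse, h.head_front]
  ext p
  simp [links_cons, links_nil, Prod.ext_iff, eq_comm, or_comm]

theorem links_insert_back (hc : IsCrossing e d N cn cp) (hty : HasType e d (!d m) (m + 1)) :
    links F.reverse ∪ links ((m + 1) :: B) =
      orient (d m) '' (newArc e d N cn cp '' Set.Ico 1 m) := by
  have hpending : {p : ℕ × ℕ | p.1 = m + 1 ∧ B.head? = some p.2} =
      orient (d m) '' (newArc e d N cn cp '' {i | IsPending e d N m i}) := by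
    ext ⟨x, y⟩
    simp only [Set.mem_ofPred_eq, h.head_back, Set.image_image, Set.mem_image]
    constructor
    · rintro ⟨rfl, hy⟩
      exact ⟨y, hy, by rw [hy.newArc_eq hc hty, orient_orient]⟩
    · rintro ⟨i, hi, hxy⟩
      rw [hi.newArc_eq hc hty, orient_orient] at hxy
      cases hxy
      exact ⟨rfl, hi⟩
  have hIco : {i | IsPending e d N m i} ∪ {i ∈ Set.Ico 1 m | ¬ IsPending e d N m i} =
      Set.Ico 1 m := by
    ext i
    have : IsPending e d N m i → i ∈ Set.Ico 1 m := fun hi => by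
      have := hi.1
      have := hi.2.1.1
      exact ⟨by omega, by omega⟩
    simp only [Set.mem_union, Set.mem_ofPred_eq]
    tauto
  rw [links_cons, Set.union_left_comm, h.links_eq, hpending, ← Set.image_union, ← Set.image_union,
    hIco]

theorem links_insert (hc : IsCrossing e d N cn cp) (hty : HasType e d (!d m) (m + 1))
    (hneg : ¬ (Turns e d (m + 1) ∧ ¬ N (m + 1))) :
    links (F.reverse ++ (m + 1) :: B) =
      orient (d m) '' (newArc e d N cn cp '' Set.Ico 1 (m + 1)) := by
  rw [links_append_cons, h.links_insert_front hneg, Set.union_right_comm,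
    h.links_insert_back hc hty, ← Set.image_singleton, ← Set.image_singleton, ← Set.image_union,
    ← Set.image_union, Set.union_singleton, ← Order.succ_eq_add_one,
    Set.insert_Ico_right_eq_Ico_succ h.one_le]

theorem succ_of_eq (hme : m + 1 < e) (hd : d (m + 1) = d m) :
    IsSlotted e d N cn cp (m + 1) ((m + 1) :: F) B := by
  have hT : ¬ Turns e d (m + 1) := fun ht => ht.2.2 hd.symm
  have hbeyond (b : Bool) : beyond e d N (m + 2) b = beyond e d N (m + 1) b :=
    beyond_succ fun ht => absurd ht hT
  have hinsert : ((m + 1) :: F).reverse ++ B = F.reverse ++ (m + 1) :: B := by simp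
  constructor
  case perm => exact hinsert ▸ h.perm_insert
  case self_mem => simp
  case head_front => simp [slotPoint, hT]
  case head_back => simpa only [isPending_succ_of_eq hd] using h.head_back
  case last_front =>
    rw [List.getLast?_cons_of_ne_nil h.front_ne_nil, hd, hbeyond]
    exact h.last_front
  case last_back =>
    rw [hd, hbeyond]
    exact h.last_back
  case back_nil =>
    intro hB s hs
    rw [hd, hbeyond] at hs
    refine lt_of_le_of_ne (h.back_nil hB s hs) ?_
    rintro rfl
    have := hs.1.2.2.1 hme
    simp [hd] at this
  case ordered =>
    rw [hinsert, hd]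
    exact fun i => h.ordered_insert
  case links_eq =>
    have hIco : {i ∈ Set.Ico 1 (m + 1) | ¬ IsPending e d N m i} =
        {i ∈ Set.Ico 1 m | ¬ IsPending e d N m i} ∪ {m} := by
      ext i
      have h1 := h.one_le
      have hm : ¬ IsPending e d N m m := fun hi => absurd hi.1 (by omega)
      by_cases him : i = m
      · simp [him, hm, h1]
      · have hlt : i ≤ m ↔ i < m := by omega
        simp [him, hlt]
    simp only [isPending_succ_of_eq hd]
    rw [hIco, hd, List.reverse_cons, h.links_insert_front fun ht => hT ht.1,
      Set.union_right_comm, h.links_eq, ← Set.image_singleton, ← Set.image_singleton,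
      ← Set.image_union, ← Set.image_union]

theorem isLeast_beyond_of_turns (ht : Turns e d (m + 1)) {s : ℕ}
    (hs : ((m + 1) :: B).getLast? = some s) : IsLeast (beyond e d N (m + 2) (d (m + 1))) s := by
  rw [beyond_succ fun _ _ => rfl]
  have hback := h.back_nil
  rw [← ht.eq_not] at hback
  by_cases hB : B = []
  · obtain rfl : m + 1 = s := by simpa [hB] using hs
    exact ⟨⟨ht.hasType, fun r hr _ _ _ => hr⟩, hback hB⟩
  · rw [ht.eq_not]
    exact h.last_back s (by rwa [List.getLast?_cons_of_ne_nil hB] at hs)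

theorem ordered_insert_reverse (ht : Turns e d (m + 1)) {i : ℕ} (hi : i ∈ Set.Ico 1 (m + 1)) :
    orient (d (m + 1)) (oldArc d i) ∈ orderedPairs (F.reverse ++ (m + 1) :: B).reverse := by
  rw [mem_orderedPairs_reverse, swap_orient, ht.eq_not, Bool.not_not]
  exact h.ordered_insert hi

theorem succ_of_neg (hc : IsCrossing e d N cn cp) (ht : Turns e d (m + 1)) (hN : N (m + 1)) :
    IsSlotted e d N cn cp (m + 1) (F.reverse ++ (m + 1) :: B) [] := by
  have hpending (i : ℕ) : ¬ IsPending e d N (m + 1) i := fun hi =>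
    ((isPending_succ_of_turns ht).1 hi).2 hN
  constructor
  case perm =>
    rw [List.append_nil]
    exact (List.reverse_perm _).trans h.perm_insert
  case self_mem => simp
  case head_front =>
    obtain ⟨c, hF⟩ := Option.ne_none_iff_exists'.1 (mt List.getLast?_eq_none_iff.1 h.front_ne_nil)
    have hcn := hc.neg _ ht hN
    rw [ht.eq_not, Bool.not_not] at hcn
    rw [List.head?_append_of_ne_nil _ (by simpa using h.front_ne_nil), List.head?_reverse, hF,
      slotPoint, if_pos ⟨ht, hN⟩, (h.last_front c hF).unique hcn]
  case head_back => simp [hpending]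
  case last_front =>
    rw [List.getLast?_append_of_ne_nil _ (by simp)]
    exact fun s => h.isLeast_beyond_of_turns ht
  case last_back => simp
  case back_nil => exact fun _ s hs => hs.2 (m + 1) (by omega) ht hN (by simp)
  case ordered =>
    rw [List.append_nil]
    exact fun i => h.ordered_insert_reverse ht
  case links_eq =>
    simp only [hpending, not_false_eq_true, and_true, Set.ofPred_mem_eq, links_nil, Set.union_empty]
    rw [links_reverse, h.links_insert hc (ht.eq_not ▸ ht.hasType) fun h => h.2 hN, Set.image_image,
      ht.eq_not]
    simp only [swap_orient]

theorem succ_of_pos (hc : IsCrossing e d N cn cp) (ht : Turns e d (m + 1)) (hN : ¬ N (m + 1)) :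
    IsSlotted e d N cn cp (m + 1) ((m + 1) :: B) F := by
  have hreverse : ((m + 1) :: B).reverse ++ F = (F.reverse ++ (m + 1) :: B).reverse := by simp
  constructor
  case perm =>
    rw [hreverse]
    exact (List.reverse_perm _).trans h.perm_insert
  case self_mem => simp
  case head_front => simp [slotPoint, hN]
  case head_back =>
    have hslot : slotPoint e d N cn m = m := if_neg fun hm => hN (hc.succ m hm.1 hm.2 ht)
    simp [isPending_succ_of_turns ht, hN, h.head_front, hslot, eq_comm]
  case last_front => exact fun s => h.isLeast_beyond_of_turns ht
  case last_back =>
    rw [ht.eq_not, Bool.not_not, beyond_succ fun _ hm => absurd hm hN]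
    exact h.last_front
  case back_nil => exact fun hF => absurd hF h.front_ne_nil
  case ordered =>
    rw [hreverse]
    exact fun i => h.ordered_insert_reverse ht
  case links_eq =>
    have hIco : {i ∈ Set.Ico 1 (m + 1) | ¬ IsPending e d N (m + 1) i} = Set.Ico 1 m := by
      ext i
      simp only [isPending_succ_of_turns ht, hN, not_false_eq_true, and_true, Set.mem_ofPred_eq,
        Set.mem_Ico]
      omega
    have hback := h.links_insert_back hc (ht.eq_not ▸ ht.hasType)
    rw [hIco, ← F.reverse_reverse, links_reverse, links_reverse F.reverse, ← Set.image_union,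
      Set.union_comm, hback, Set.image_image, ht.eq_not]
    simp only [swap_orient]

end IsSlotted

theorem exists_isSlotted (hc : IsCrossing e d N cn cp) (m : ℕ) (hm : 1 ≤ m) (hme : m < e) :
    ∃ F B, IsSlotted e d N cn cp m F B := by
  induction m, hm using Nat.le_induction with
  | base => exact ⟨_, _, isSlotted_one hme⟩
  | succ m hm ih =>
    obtain ⟨F, B, h⟩ := ih (by omega)
    by_cases hd : d (m + 1) = d m
    · exact ⟨_, _, h.succ_of_eq hme hd⟩
    · have ht : Turns e d (m + 1) := ⟨by omega, hme, Ne.symm hd⟩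
      by_cases hN : N (m + 1)
      · exact ⟨_, _, h.succ_of_neg hc ht hN⟩
      · exact ⟨_, _, h.succ_of_pos hc ht hN⟩

theorem exists_list_links_eq (he : 1 < e) (hc : IsCrossing e d N cn cp) :
    ∃ L : List ℕ, L.Perm (List.range' 1 e) ∧ links L = newArc e d N cn cp '' Set.Ico 1 e ∧
      ∀ i ∈ Set.Ico 1 e, oldArc d i ∈ orderedPairs L := by
  obtain ⟨m, rfl⟩ : ∃ m, e = m + 1 := ⟨e - 1, by omega⟩
  obtain ⟨F, B, h⟩ := exists_isSlotted hc m (by omega) (by omega)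
  have hty : HasType (m + 1) d (!d m) (m + 1) :=
    ⟨by omega, le_rfl, fun h => absurd h (lt_irrefl _), fun _ => by simp⟩
  have hlinks := h.links_insert hc hty fun h => lt_irrefl _ h.1.2.1
  have hordered := fun i => h.ordered_insert (i := i)
  cases hdm : d m <;> rw [hdm] at hlinks hordered
  · refine ⟨_, (List.reverse_perm _).trans h.perm_insert, ?_, fun i hi => ?_⟩
    · rw [links_reverse, hlinks, Set.image_image]
      simp [orient]
    · rw [mem_orderedPairs_reverse]
      exact hordered i hi
  · exact ⟨_, h.perm_insert, hlinks.trans (Set.image_id _), hordered⟩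

end Zigzag

/-! ### Simple systems of type `A` -/

section TypeA

theorem root_apply (r s i : ℕ) :
    root r s i = (if i = r then 1 else 0) - (if i = s then 1 else 0) := by
  simp [root, Pi.single_apply]

theorem neg_root (r s : ℕ) : -root r s = root s r := by simp [root]

theorem root_add_root (r s t : ℕ) : root r s + root s t = root r t := by simp [root]

theorem natSpan_mono {X Y : Set (ℕ → ℤ)} (h : X ⊆ Y) : natSpan X ⊆ natSpan Y :=
  AddSubmonoid.closure_mono h

/-- The simple system given by the path through the entries of a list. -/
def linkRoots (L : List ℕ) : Set (ℕ → ℤ) := (fun p => root p.1 p.2) '' links L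

theorem linkRoots_cons_cons (x y : ℕ) (L : List ℕ) :
    linkRoots (x :: y :: L) = insert (root x y) (linkRoots (y :: L)) := by
  have hxy : {p : ℕ × ℕ | p.1 = x ∧ (y :: L).head? = some p.2} = {(x, y)} := by
    ext p
    simp [Prod.ext_iff, eq_comm]
  rw [linkRoots, links_cons, hxy, Set.image_union, Set.image_singleton, Set.singleton_union,
    linkRoots]

theorem linkRoots_subset_cons (x : ℕ) (L : List ℕ) : linkRoots L ⊆ linkRoots (x :: L) := by
  rw [linkRoots, linkRoots, links_cons]
  exact Set.image_mono Set.subset_union_right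

theorem root_head_mem_natSpan {x y : ℕ} {L : List ℕ} (hy : y ∈ L) :
    root x y ∈ natSpan (linkRoots (x :: L)) := by
  induction L generalizing x with
  | nil => simp at hy
  | cons z L ih =>
    have hz : root x z ∈ natSpan (linkRoots (x :: z :: L)) :=
      AddSubmonoid.subset_closure (by rw [linkRoots_cons_cons]; exact Set.mem_insert _ _)
    rcases List.mem_cons.1 hy with rfl | hy
    · exact hz
    · rw [← root_add_root x z y]
      exact AddSubmonoid.add_mem _ hz (natSpan_mono (linkRoots_subset_cons _ _) (ih hy))

theorem root_mem_natSpan_linkRoots {L : List ℕ} {x y : ℕ} (h : (x, y) ∈ orderedPairs L) :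
    root x y ∈ natSpan (linkRoots L) := by
  induction L with
  | nil => simp [orderedPairs] at h
  | cons z L ih =>
    rcases List.sublist_cons_iff.1 h with h | ⟨r, hr, h⟩
    · exact natSpan_mono (linkRoots_subset_cons _ _) (ih h)
    · obtain ⟨rfl, rfl⟩ := List.cons_eq_cons.1 hr
      exact root_head_mem_natSpan (by simpa using h)

/-- The difference of the entries of `L` at the positions `k` and `k + 1`. -/
def linkRoot (L : List ℕ) (k : Fin (L.length - 1)) : ℕ → ℤ := root L[k] L[(k : ℕ) + 1]

theorem linkRoots_eq_range (L : List ℕ) : linkRoots L = Set.range (linkRoot L) := by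
  ext γ
  constructor
  · rintro ⟨p, hp, rfl⟩
    obtain ⟨k, hk, rfl⟩ := mem_links_iff_getElem.1 hp
    exact ⟨⟨k, by omega⟩, rfl⟩
  · rintro ⟨k, rfl⟩
    exact ⟨_, mem_links_iff_getElem.2 ⟨k, by omega, rfl⟩, rfl⟩

theorem linkRoot_getElem {L : List ℕ} (hL : L.Nodup) (k : Fin (L.length - 1)) {i : ℕ}
    (hi : i < L.length) :
    linkRoot L k L[i] = (if i = k then 1 else 0) - (if i = (k : ℕ) + 1 then 1 else 0) := by
  simp [linkRoot, root_apply, hL.getElem_inj_iff]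

theorem linearIndependent_linkRoot {L : List ℕ} (hL : L.Nodup) :
    LinearIndependent ℤ (linkRoot L) := by
  rw [Fintype.linearIndependent_iff]
  intro g hg j
  -- The entries up to `j` meet only the `j`-th link in exactly one end.
  have hsum (k : Fin (L.length - 1)) :
      ∑ i : Fin (j + 1), linkRoot L k L[(i : ℕ)] = if k = j then 1 else 0 := by
    simp only [linkRoot_getElem hL, Finset.sum_sub_distrib]
    rw [Fin.sum_univ_eq_sum_range (fun i => if i = (k : ℕ) then (1 : ℤ) else 0),
      Fin.sum_univ_eq_sum_range (fun i => if i = (k : ℕ) + 1 then (1 : ℤ) else 0),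
      Finset.sum_ite_eq', Finset.sum_ite_eq']
    simp only [Finset.mem_range, Fin.ext_iff]
    split_ifs <;> omega
  have h : ∑ i : Fin (j + 1), (∑ k, g k • linkRoot L k) L[(i : ℕ)] = 0 := by
    simp only [hg, Pi.zero_apply, Finset.sum_const_zero]
  simp only [Finset.sum_apply, Pi.smul_apply, smul_eq_mul] at h
  rw [Finset.sum_comm] at h
  simpa [← Finset.mul_sum, hsum] using h

theorem isSimpleSystem_linkRoots {L : List ℕ} (hL : L.Nodup) :
    IsSimpleSystem (rootsOn {x | x ∈ L}) (linkRoots L) where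
  subset := by
    rw [linkRoots_eq_range]
    rintro _ ⟨k, rfl⟩
    refine ⟨_, List.getElem_mem _, _, List.getElem_mem _, ?_, rfl⟩
    simp [hL.getElem_inj_iff]
  linearIndependent := by
    rw [linkRoots_eq_range]
    exact (linearIndependent_linkRoot hL).linearIndepOn_id
  pos_or_neg := by
    rintro _ ⟨x, hx, y, hy, hxy, rfl⟩
    rw [neg_root]
    exact (mem_orderedPairs_or_swap hx hy hxy).imp root_mem_natSpan_linkRoots
      root_mem_natSpan_linkRoots

theorem scalar_root {n r s : ℕ} (hr : r ∈ Finset.Icc 1 n) (hs : s ∈ Finset.Icc 1 n)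
    (γ : ℕ → ℤ) : scalar n (root r s) γ = γ r - γ s := by
  simp only [scalar, root_apply, sub_mul, Finset.sum_sub_distrib, ite_mul, one_mul, zero_mul,
    Finset.sum_ite_eq', hr, hs, if_true]

theorem isOfTypeA_linkRoots {n : ℕ} {L : List ℕ} (hL : L.Nodup)
    (hn : ∀ x ∈ L, x ∈ Finset.Icc 1 n) : IsOfTypeA n (L.length - 1) (linkRoots L) := by
  have hinj := (linearIndependent_linkRoot hL).injective
  refine ⟨(Equiv.ofInjective _ hinj).trans (Equiv.setCongr (linkRoots_eq_range L).symm), ?_⟩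
  intro j k
  have h : scalar n (linkRoot L j) (linkRoot L k) = CartanMatrix.A (L.length - 1) j k := by
    have hscalar : scalar n (linkRoot L j) (linkRoot L k) =
        linkRoot L k L[j] - linkRoot L k L[(j : ℕ) + 1] :=
      scalar_root (hn _ (List.getElem_mem _)) (hn _ (List.getElem_mem _)) _
    rw [hscalar]
    simp only [Fin.getElem_fin, linkRoot_getElem hL, CartanMatrix.A, Matrix.of_apply, Fin.ext_iff]
    split_ifs <;> omega
  exact h

end TypeA

/-! ### Parts and the roots in `K` -/

section Parts

/-- `x < y` or `y < x` according to the direction of arrows on the side `b`. -/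
def Before (b : Bool) (x y : ℕ) : Prop := if b then x < y else y < x

theorem before_true {x y : ℕ} : Before true x y ↔ x < y := Iff.rfl

theorem before_false {x y : ℕ} : Before false x y ↔ y < x := Iff.rfl

theorem before_not {b : Bool} {x y : ℕ} : Before (!b) x y ↔ Before b y x := by
  cases b <;> rfl

theorem not_beq (b d : Bool) : ((!b) == d) = !(b == d) := by
  decide +revert

theorem beq_not (b d : Bool) : (b == !d) = !(b == d) := by
  decide +revert

theorem Before.trans {b : Bool} {x y z : ℕ} (h : Before b x y) (h' : Before b y z) :
    Before b x z := by
  cases b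
  · exact lt_trans (b := y) h' h
  · exact lt_trans (b := y) h h'

theorem Before.asymm {b : Bool} {x y : ℕ} (h : Before b x y) : ¬ Before b y x := by
  cases b <;> exact lt_asymm (α := ℕ) h

theorem before_or_before {x y : ℕ} (b : Bool) (h : x ≠ y) : Before b x y ∨ Before b y x := by
  cases b
  · exact (lt_or_gt_of_ne h).symm
  · exact lt_or_gt_of_ne h

/-- `x` and `y` lie in the same part, an interval. -/
def SamePart {n : ℕ} (P : Finpartition (Finset.Icc 1 n)) (x y : ℕ) : Prop :=
  ∃ p q, Finset.Icc p q ∈ P.parts ∧ (p ≤ x ∧ x ≤ q) ∧ p ≤ y ∧ y ≤ q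

variable {n : ℕ} {P : Finpartition (Finset.Icc 1 n)}

theorem part_unique {p q p' q' x : ℕ} (h : Finset.Icc p q ∈ P.parts)
    (h' : Finset.Icc p' q' ∈ P.parts) (hx : p ≤ x ∧ x ≤ q) (hx' : p' ≤ x ∧ x ≤ q') :
    p = p' ∧ q = q' := by
  have heq := P.eq_of_mem_parts h h' (Finset.mem_Icc.2 hx) (Finset.mem_Icc.2 hx')
  have hsub := (Finset.Icc_subset_Icc_iff (hx.1.trans hx.2)).1 heq.le
  have hsup := (Finset.Icc_subset_Icc_iff (hx'.1.trans hx'.2)).1 heq.ge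
  exact ⟨le_antisymm hsup.1 hsub.1, le_antisymm hsub.2 hsup.2⟩

theorem exists_part (hP : IsConnectedPartition P) {x : ℕ} (hx : x ∈ Finset.Icc 1 n) :
    ∃ p q, Finset.Icc p q ∈ P.parts ∧ p ≤ x ∧ x ≤ q := by
  obtain ⟨B, hB, hxB⟩ := P.exists_mem hx
  obtain ⟨p, q, rfl⟩ := hP B hB
  exact ⟨p, q, hB, Finset.mem_Icc.1 hxB⟩

theorem mem_Icc_of_mem_part {p q x : ℕ} (h : Finset.Icc p q ∈ P.parts) (hx : p ≤ x ∧ x ≤ q) :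
    1 ≤ x ∧ x ≤ n :=
  Finset.mem_Icc.1 (P.le h (Finset.mem_Icc.2 hx))

theorem SamePart.symm {x y : ℕ} (h : SamePart P x y) : SamePart P y x := by
  obtain ⟨p, q, h, hx, hy⟩ := h
  exact ⟨p, q, h, hy, hx⟩

theorem samePart_comm {x y : ℕ} : SamePart P x y ↔ SamePart P y x := ⟨.symm, .symm⟩

theorem SamePart.trans {x y z : ℕ} (h : SamePart P x y) (h' : SamePart P y z) :
    SamePart P x z := by
  obtain ⟨p, q, h, hx, hy⟩ := h
  obtain ⟨p', q', h', hx', hy'⟩ := h'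
  obtain ⟨rfl, rfl⟩ := part_unique h h' hy hx'
  exact ⟨p, q, h, hx, hy'⟩

theorem SamePart.of_between {x y z : ℕ} {c : Bool} (h : SamePart P x z) (hxy : Before c x y)
    (hyz : Before c y z) : SamePart P x y := by
  obtain ⟨p, q, h, hx, hz⟩ := h
  refine ⟨p, q, h, hx, ?_⟩
  cases c
  · rw [before_false] at hxy hyz
    omega
  · rw [before_true] at hxy hyz
    omega

theorem samePart_of_mem_simpleIndices (hP : IsConnectedPartition P) {k : ℕ}
    (hk : k ∈ simpleIndices P) : SamePart P k (k + 1) := by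
  obtain ⟨B, hB, h1, h2⟩ := hk
  obtain ⟨p, q, rfl⟩ := hP B hB
  exact ⟨p, q, hB, Finset.mem_Icc.1 h1, Finset.mem_Icc.1 h2⟩

theorem samePart_of_forall_succ {x y : ℕ} (hxy : x < y)
    (h : ∀ k ∈ Set.Ico x y, SamePart P k (k + 1)) : SamePart P x y := by
  induction y, hxy using Nat.le_induction with
  | base => exact h x ⟨le_rfl, x.lt_succ_self⟩
  | succ y hy ih =>
    exact (ih fun k hk => h k ⟨hk.1, hk.2.trans y.lt_succ_self⟩).trans
      (h y ⟨(Nat.lt_of_succ_le hy).le, y.lt_succ_self⟩)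

theorem sum_range_root (k x y : ℕ) : ∑ i ∈ Finset.range (k + 1), root x y i =
    (if x ≤ k then 1 else 0) - (if y ≤ k then 1 else 0) := by
  simp [root_apply, Finset.sum_sub_distrib]

/-- The partial sum up to `k` is the coefficient of the simple root `α_k`. -/
theorem sum_range_of_mem_natSpan {I : Set ℕ} {γ : ℕ → ℤ} (h : γ ∈ natSpan (simpleRoot '' I))
    (k : ℕ) : 0 ≤ ∑ i ∈ Finset.range (k + 1), γ i ∧
      (k ∉ I → ∑ i ∈ Finset.range (k + 1), γ i = 0) := by
  induction h using AddSubmonoid.closure_induction with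
  | mem γ h =>
    obtain ⟨i, hi, rfl⟩ := h
    rw [simpleRoot, sum_range_root]
    refine ⟨by split_ifs <;> omega, fun hk => ?_⟩
    have : k ≠ i := fun h => hk (h ▸ hi)
    split_ifs <;> omega
  | zero => simp
  | add x y _ _ hx hy =>
    simp only [Pi.add_apply, Finset.sum_add_distrib]
    refine ⟨add_nonneg hx.1 hy.1, fun hk => ?_⟩
    rw [hx.2 hk, hy.2 hk, add_zero]

theorem lt_of_root_mem_natSpan {I : Set ℕ} {x y : ℕ} (hxy : x ≠ y)
    (h : root x y ∈ natSpan (simpleRoot '' I)) : x < y := by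
  have := (sum_range_of_mem_natSpan h y).1
  rw [sum_range_root] at this
  split_ifs at this <;> omega

theorem Ico_subset_of_root_mem_natSpan {I : Set ℕ} {x y : ℕ}
    (h : root x y ∈ natSpan (simpleRoot '' I)) : Set.Ico x y ⊆ I := by
  rintro k ⟨hxk, hky⟩
  by_contra hk
  have := (sum_range_of_mem_natSpan h k).2 hk
  rw [sum_range_root, if_pos hxk, if_neg hky.not_ge] at this
  omega

theorem root_mem_natSpan_of_Ico_subset {I : Set ℕ} {x y : ℕ} (hxy : x < y)
    (h : Set.Ico x y ⊆ I) : root x y ∈ natSpan (simpleRoot '' I) := by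
  induction y, hxy using Nat.le_induction with
  | base => exact AddSubmonoid.subset_closure ⟨x, h ⟨le_rfl, x.lt_succ_self⟩, rfl⟩
  | succ y hy ih =>
    rw [← root_add_root x y]
    exact AddSubmonoid.add_mem _ (ih ((Set.Ico_subset_Ico_right y.le_succ).trans h))
      (AddSubmonoid.subset_closure ⟨y, h ⟨(Nat.lt_of_succ_le hy).le, y.lt_succ_self⟩, rfl⟩)

theorem root_mem_natSpan_simpleIndices_iff (hP : IsConnectedPartition P) {x y : ℕ}
    (hxy : x ≠ y) :
    root x y ∈ natSpan (simpleRoot '' simpleIndices P) ↔ x < y ∧ SamePart P x y := by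
  constructor
  · intro h
    have hlt := lt_of_root_mem_natSpan hxy h
    exact ⟨hlt, samePart_of_forall_succ hlt fun k hk =>
      samePart_of_mem_simpleIndices hP (Ico_subset_of_root_mem_natSpan h hk)⟩
  · rintro ⟨hlt, p, q, hpq, hx, hy⟩
    refine root_mem_natSpan_of_Ico_subset hlt fun k hk => ⟨_, hpq, ?_⟩
    simp only [Finset.mem_Icc, Set.mem_Ico] at hk ⊢
    omega

variable {J : Bool → Finpartition (Finset.Icc 1 n)}

theorem root_mem_rootsK_iff (hJ : ∀ b, IsConnectedPartition (J b)) {x y : ℕ}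
    (hx : x ∈ Set.Icc 1 n) (hy : y ∈ Set.Icc 1 n) (hxy : x ≠ y) :
    root x y ∈ rootsK J ↔ ∀ c, Before c x y → ¬ SamePart (J c) x y := by
  have hD : root x y ∈ Delta n := ⟨x, hx, y, hy, hxy, rfl⟩
  simp only [rootsK, rootsR, Set.mem_sdiff, Set.mem_ofPred_eq, hD, true_and, neg_root,
    root_mem_natSpan_simpleIndices_iff (hJ _) hxy,
    root_mem_natSpan_simpleIndices_iff (hJ _) hxy.symm, not_or, not_and, Bool.forall_bool,
    before_true, before_false, samePart_comm (x := y)]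
  exact and_comm

theorem isNil_root_iff (hJ : ∀ b, IsConnectedPartition (J b)) {x y : ℕ}
    (hx : x ∈ Set.Icc 1 n) (hy : y ∈ Set.Icc 1 n) (hxy : x ≠ y) :
    IsNil J (root x y) ↔ ∃ c, ¬ SamePart (J c) x y := by
  simp only [IsNil, neg_root, root_mem_rootsK_iff hJ hx hy hxy,
    root_mem_rootsK_iff hJ hy hx hxy.symm, Bool.forall_bool, Bool.exists_bool, before_true,
    before_false, samePart_comm (x := y)]
  rcases lt_or_gt_of_ne hxy with h | h <;> simp only [h, h.not_gt] <;> tauto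

end Parts

/-! ### Meanders with a fixed point -/

section Meanders

theorem orbit_closure_subset {α : Type*} {f g : Equiv.Perm α} (hf : f * f = 1) (hg : g * g = 1)
    {X : Set α} (hfX : ∀ x ∈ X, f x ∈ X) (hgX : ∀ x ∈ X, g x ∈ X) {x : α} (hx : x ∈ X) :
    MulAction.orbit (Subgroup.closure {f, g}) x ⊆ X := by
  have key : ∀ w ∈ Subgroup.closure {f, g}, ∀ z ∈ X, w z ∈ X := by
    intro w hw
    induction hw using Subgroup.closure_induction'' with
    | mem w hw => rcases hw with rfl | rfl <;> assumption
    | inv_mem w hw =>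
      rcases hw with rfl | rfl
      · rwa [inv_eq_of_mul_eq_one_right hf]
      · rwa [inv_eq_of_mul_eq_one_right hg]
    | one => exact fun z hz => hz
    | mul _ w _ _ h h' => exact fun z hz => h _ (h' z hz)
  rintro _ ⟨⟨w, hw⟩, rfl⟩
  exact key w hw x hx

/-- `g` inverts `f * g`, so it maps `(f * g) ^ k x` to `(f * g) ^ (-k) x`. -/
theorem apply_mem_orbit_zpowers {α : Type*} {f g : Equiv.Perm α} (hf : f * f = 1)
    (hg : g * g = 1) {x y : α} (hx : g x = x)
    (hy : y ∈ MulAction.orbit (Subgroup.zpowers (f * g)) x) :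
    g y ∈ MulAction.orbit (Subgroup.zpowers (f * g)) x := by
  obtain ⟨⟨_, k, rfl⟩, rfl⟩ := hy
  have hinv : SemiconjBy g (f * g) (f * g)⁻¹ := by
    rw [SemiconjBy, mul_inv_rev, inv_eq_of_mul_eq_one_right hf, inv_eq_of_mul_eq_one_right hg,
      mul_assoc]
  refine ⟨⟨_, -k, rfl⟩, ?_⟩
  have h := Equiv.congr_fun (hinv.zpow_right k) x
  rw [inv_zpow', Equiv.Perm.mul_apply, Equiv.Perm.mul_apply, hx] at h
  exact h.symm

theorem isEdge_of_fixed {f g : Equiv.Perm ℕ} (hf : f * f = 1) (hg : g * g = 1) {E : Set ℕ}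
    (hE : IsMeander f g E) {x : ℕ} (hxE : x ∈ E) (hx : g x = x) : IsEdge f g E := by
  refine ⟨hE, x, ?_⟩
  obtain ⟨y, rfl⟩ := hE
  rw [← MulAction.orbit_eq_iff.2 hxE]
  have hgX := fun z hz => apply_mem_orbit_zpowers (y := z) hf hg hx hz
  refine (orbit_closure_subset hf hg (fun z hz => ?_) hgX (MulAction.mem_orbit_self x)).antisymm ?_
  · have hfz : (f * g) (g z) = f z := by rw [← Equiv.Perm.mul_apply, mul_assoc, hg, mul_one]
    rw [← hfz]
    exact MulAction.mem_orbit_of_mem_orbit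
      (⟨f * g, Subgroup.mem_zpowers _⟩ : Subgroup.zpowers (f * g)) (hgX z hz)
  · rintro _ ⟨⟨w, hw⟩, rfl⟩
    have hle : Subgroup.zpowers (f * g) ≤ Subgroup.closure {f, g} :=
      Subgroup.zpowers_le.2 (mul_mem (Subgroup.subset_closure (Set.mem_insert _ _))
        (Subgroup.subset_closure (Set.mem_insert_of_mem _ rfl)))
    exact ⟨⟨w, hle hw⟩, rfl⟩

end Meanders

/-! ### Modified involutions respect the parts -/

section ModifiedInvolution

theorem kappa_apply {p q x : ℕ} (hx : p ≤ x ∧ x ≤ q) : kappa p q x = p + q - x :=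
  if_pos hx

theorem kappa_mul_self (p q : ℕ) : kappa p q * kappa p q = 1 :=
  Equiv.ext fun x => reflectFun_involutive p q x

variable {n : ℕ} {P : Finpartition (Finset.Icc 1 n)} {M : Set ℕ} {σ : Equiv.Perm ℕ} {p q : ℕ}

theorem mark_le (hM : ∀ i ∈ M, ∃ j, IsHalfArc P i j) (hpq : Finset.Icc p q ∈ P.parts)
    {i : ℕ} (hi : i ∈ M) (h : p ≤ i ∧ i ≤ q) : 2 * i + 1 ≤ p + q := by
  obtain ⟨j, p', q', h', h1, h2, h3⟩ := hM i hi
  obtain ⟨rfl, rfl⟩ := part_unique hpq h' h ⟨h1, by omega⟩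
  omega

theorem mem_extLeft_bounds (hM : ∀ i ∈ M, ∃ j, IsHalfArc P i j)
    (hpq : Finset.Icc p q ∈ P.parts) {u v x : ℕ} (huv : IsMarkComponent M p q u v)
    (hx : x ∈ extLeft p q u v) : p ≤ x ∧ 2 * x ≤ p + q ∧ u ≤ x ∧ x ≤ v + 1 ∧
      (x = v + 1 → 2 * v + 1 ≠ p + q) := by
  obtain ⟨h1, h2, h3, h4, -, -⟩ := huv
  have := mark_le hM hpq (h4 v ⟨h2, le_rfl⟩) ⟨by omega, h3⟩
  rw [extLeft, Set.mem_Icc] at hx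
  split_ifs at hx <;> omega

theorem mem_extRight_iff (hM : ∀ i ∈ M, ∃ j, IsHalfArc P i j)
    (hpq : Finset.Icc p q ∈ P.parts) {u v x : ℕ} (huv : IsMarkComponent M p q u v) :
    x ∈ extRight p q u v ↔ p ≤ x ∧ x ≤ q ∧ p + q - x ∈ extLeft p q u v := by
  constructor
  · rintro ⟨y, hy, rfl⟩
    have := mem_extLeft_bounds hM hpq huv hy
    rw [kappa_apply (by omega)]
    refine ⟨by omega, by omega, ?_⟩
    rwa [show p + q - (p + q - y) = y by omega]
  · rintro ⟨h1, h2, h3⟩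
    refine ⟨_, h3, ?_⟩
    rw [kappa_apply (by omega)]
    omega

theorem mem_extComponent_bounds (hM : ∀ i ∈ M, ∃ j, IsHalfArc P i j)
    (hpq : Finset.Icc p q ∈ P.parts) {u v x : ℕ} (huv : IsMarkComponent M p q u v)
    (hx : x ∈ extComponent p q u v) : u ≤ x ∧ u + x ≤ p + q ∧
      (2 * x = p + q → x = v + 1) := by
  obtain ⟨hpu, huv', hvq, hMv, -, -⟩ := id huv
  have hv := mark_le hM hpq (hMv v ⟨huv', le_rfl⟩) ⟨hpu.trans huv', hvq⟩
  rcases hx with h | h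
  · have := mem_extLeft_bounds hM hpq huv h
    omega
  · rw [mem_extRight_iff hM hpq huv] at h
    have := mem_extLeft_bounds hM hpq huv h.2.2
    omega

theorem IsModifiedInvolution.bounds (hσ : IsModifiedInvolution P M σ)
    (hM : ∀ i ∈ M, ∃ j, IsHalfArc P i j) (hpq : Finset.Icc p q ∈ P.parts) {x : ℕ}
    (hx : p ≤ x ∧ x ≤ q) : (p ≤ σ x ∧ σ x ≤ q) ∧ (σ x < x → p + q ≤ 2 * x) ∧
      (x < σ x → 2 * x ≤ p + q) := by
  by_cases h : ∃ u v, IsMarkComponent M p q u v ∧ x ∈ extComponent p q u v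
  · obtain ⟨u, v, huv, hxE⟩ := h
    by_cases hfix : σ x = x
    · rw [hfix]; exact ⟨hx, by omega, by omega⟩
    · rcases (hσ.modified p q hpq u v huv).opposite x hxE hfix with ⟨h1, h2⟩ | ⟨h1, h2⟩
      · rw [mem_extRight_iff hM hpq huv] at h2
        have h3 := mem_extLeft_bounds hM hpq huv h1
        have h4 := mem_extLeft_bounds hM hpq huv h2.2.2
        omega
      · rw [mem_extRight_iff hM hpq huv] at h1
        have h3 := mem_extLeft_bounds hM hpq huv h1.2.2
        have h4 := mem_extLeft_bounds hM hpq huv h2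
        omega
  · push Not at h
    rw [hσ.unmodified p q hpq x hx h, kappa_apply hx]
    omega

/-- A fixed point makes the meander of `⟨κ, σ⟩` on its extended component an edge, so this component
reaches the centre. -/
theorem IsModifiedInvolution.mem_of_fixed (hσ : IsModifiedInvolution P M σ)
    (hM : ∀ i ∈ M, ∃ j, IsHalfArc P i j) (hpq : Finset.Icc p q ∈ P.parts) {z : ℕ}
    (hz : p ≤ z ∧ z ≤ q) (hfix : σ z = z) {i : ℕ} (hi : z ≤ i ∨ p + q - z ≤ i)
    (hic : 2 * i + 1 ≤ p + q) : i ∈ M := by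
  by_cases h : ∃ u v, IsMarkComponent M p q u v ∧ z ∈ extComponent p q u v
  · obtain ⟨u, v, huv, hzE⟩ := h
    have hv : ¬ 2 * v + 2 < p + q := fun hlt => by
      have hloop := (hσ.modified p q hpq u v huv).meander
      rw [if_pos hlt] at hloop
      exact hloop.2 (isEdge_of_fixed (kappa_mul_self p q) (Equiv.ext hσ.involutive) hloop.1 hzE
        hfix)
    have hu := mem_extComponent_bounds hM hpq huv hzE
    exact huv.2.2.2.1 i ⟨by omega, by omega⟩
  · push Not at h
    have := hσ.unmodified p q hpq z hz h
    rw [hfix, kappa_apply hz] at this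
    omega

theorem IsModifiedInvolution.pred_mem_of_centre_ne (hσ : IsModifiedInvolution P M σ)
    (hM : ∀ i ∈ M, ∃ j, IsHalfArc P i j) (hpq : Finset.Icc p q ∈ P.parts) {x : ℕ}
    (hx : p ≤ x ∧ x ≤ q) (hc : 2 * x = p + q) (hne : σ x ≠ x) : x - 1 ∈ M := by
  by_cases h : ∃ u v, IsMarkComponent M p q u v ∧ x ∈ extComponent p q u v
  · obtain ⟨u, v, huv, hxE⟩ := h
    rw [(mem_extComponent_bounds hM hpq huv hxE).2.2 hc, Nat.add_sub_cancel]
    exact huv.2.2.2.1 v ⟨huv.2.1, le_rfl⟩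
  · push Not at h
    have := hσ.unmodified p q hpq x hx h
    rw [kappa_apply hx] at this
    omega

end ModifiedInvolution

section Ordering

variable {n : ℕ} {J : Bool → Finpartition (Finset.Icc 1 n)} {M : Bool → Set ℕ}
  {σ : Bool → Equiv.Perm ℕ} {b : Bool} {p q : ℕ}

theorem IsHalfArc.sameHalfMeander {i j : ℕ} (h : IsHalfArc (J b) i j) : SameHalfMeander J i j :=
  Relation.EqvGen.rel _ _ ⟨b, h⟩

theorem HalfMeanderIsEdge.of_same {i j : ℕ} (hij : SameHalfMeander J i j)
    (hj : HalfMeanderIsEdge J j) : HalfMeanderIsEdge J i := by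
  obtain ⟨k, hk, hend⟩ := hj
  exact ⟨k, hij.trans _ _ _ hk, hend⟩

theorem IsMarking.unique (hM : IsMarking J M) {c c' : Bool} {i j : ℕ} (hi : i ∈ M c)
    (hj : j ∈ M c') (h : SameHalfMeander J i j) : c = c' ∧ i = j := by
  obtain ⟨k, p, q, hpq, h1, h2, h3⟩ := hM.isArc c i hi
  have hn := mem_Icc_of_mem_part hpq (x := i) ⟨h1, by omega⟩
  have hn' := mem_Icc_of_mem_part hpq (x := i + 1) ⟨by omega, by omega⟩
  have := (hM.existsUnique i ⟨hn.1, by omega⟩).unique (y₁ := (c, i)) (y₂ := (c', j))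
    ⟨hi, Relation.EqvGen.refl _⟩ ⟨hj, h⟩
  simpa using this

/-- The half-integer points strictly between the point `z` of the part `[p, q]` and its centre. -/
def towardsCentre (p q z : ℕ) : Set ℕ :=
  {i | (z ≤ i ∧ 2 * i + 1 < p + q) ∨ (i < z ∧ p + q < 2 * i + 1)}

/-- The arcs of a part inside the reflection of a fixed point are all marked, hence they lie on
distinct half-integer meanders. -/
theorem exists_mark_of_mem_towardsCentre (hM : IsMarking J M)
    (hσ : IsModifiedInvolution (J b) (M b) (σ b)) (hpq : Finset.Icc p q ∈ (J b).parts) {z : ℕ}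
    (hz : p ≤ z ∧ z ≤ q) (hfix : σ b z = z) {i : ℕ} (hi : i ∈ towardsCentre p q z) :
    ∃ j ∈ M b, SameHalfMeander J i j ∧ (i = j ∨ i + j + 1 = p + q) ∧ p ≤ j ∧
      2 * j + 1 < p + q := by
  have hmark := fun j => hσ.mem_of_fixed (hM.isArc b) hpq hz hfix (i := j)
  rcases hi with ⟨hzi, hic⟩ | ⟨hiz, hic⟩
  · exact ⟨i, hmark i (.inl hzi) hic.le, .refl _, .inl rfl, hz.1.trans hzi, hic⟩
  · have harc : IsHalfArc (J b) (p + q - 1 - i) i := ⟨p, q, hpq, by omega, by omega, by omega⟩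
    exact ⟨p + q - 1 - i, hmark _ (.inr (by omega)) (by omega), harc.sameHalfMeander.symm,
      .inr (by omega), by omega, by omega⟩

section Fixed

variable (hM : IsMarking J M) (hσ : IsModifiedInvolution (J b) (M b) (σ b))
  (hpq : Finset.Icc p q ∈ (J b).parts) {z : ℕ} (hz : p ≤ z ∧ z ≤ q) (hfix : σ b z = z)

include hM hσ hpq hz hfix

theorem eq_of_sameHalfMeander_of_fixed {i k : ℕ} (hi : i ∈ towardsCentre p q z)
    (hk : k ∈ towardsCentre p q z) (h : SameHalfMeander J i k) : i = k := by
  obtain ⟨j, hj, hij, hj', -⟩ := exists_mark_of_mem_towardsCentre hM hσ hpq hz hfix hi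
  obtain ⟨l, hl, hkl, hl', -⟩ := exists_mark_of_mem_towardsCentre hM hσ hpq hz hfix hk
  have hjl := (hM.unique hj hl ((hij.symm.trans _ _ _ h).trans _ _ _ hkl)).2
  rw [towardsCentre, Set.mem_ofPred_eq] at hi hk
  omega

theorem not_sameHalfMeander_of_fixed {i k : ℕ} (hi : i ∈ towardsCentre p q z)
    (hk : k ∈ M (!b)) : ¬ SameHalfMeander J k i := fun h => by
  obtain ⟨j, hj, hij, -⟩ := exists_mark_of_mem_towardsCentre hM hσ hpq hz hfix hi
  exact Bool.not_ne_self b (hM.unique hk hj (h.trans _ _ _ hij)).1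

theorem not_halfMeanderIsEdge_of_fixed {i : ℕ} (hi : i ∈ towardsCentre p q z) :
    ¬ HalfMeanderIsEdge J i := fun h => by
  obtain ⟨j, hj, hij, -, hpj, hjc⟩ := exists_mark_of_mem_towardsCentre hM hσ hpq hz hfix hi
  obtain ⟨p', q', hpq', h1, -, h2⟩ := hM.isEnd b j hj (h.of_same hij.symm)
  obtain ⟨rfl, rfl⟩ := part_unique hpq hpq' (x := j) (by omega) (by omega)
  omega

/-- Where the centre of a part on the other side meets the interval between `lo` and `hi`, there is
either a second marked arc on one half-integer meander, or a marked arc that is not an end of its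
edge, unless this centre is a fixed end-point of the interval. -/
theorem exists_centre_fixed (hσ' : IsModifiedInvolution (J (!b)) (M (!b)) (σ (!b)))
    {lo hi p' q' : ℕ} (hlt : lo < hi) (hrun : Set.Ico lo hi ⊆ towardsCentre p q z)
    (hpq' : Finset.Icc p' q' ∈ (J (!b)).parts) (hlt' : p' < q') (hlo : 2 * lo ≤ p' + q')
    (hhi : p' + q' ≤ 2 * hi) : ∃ y ∈ ({lo, hi} : Set ℕ), 2 * y = p' + q' ∧ σ (!b) y = y := by
  rcases Nat.even_or_odd' (p' + q') with ⟨k, hk | hk⟩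
  · have hkpq : p' ≤ k ∧ k ≤ q' := by omega
    have harc : IsHalfArc (J (!b)) (k - 1) k := ⟨p', q', hpq', by omega, by omega, by omega⟩
    have hend : k = lo ∨ k = hi := by
      by_contra! h
      have := eq_of_sameHalfMeander_of_fixed hM hσ hpq hz hfix (hrun (a := k - 1) (by grind))
        (hrun (a := k) (by grind)) harc.sameHalfMeander
      omega
    refine ⟨k, hend, hk.symm, ?_⟩
    by_contra hne
    have hmark := hσ'.pred_mem_of_centre_ne (hM.isArc _) hpq' hkpq hk.symm hne
    rcases hend with rfl | rfl
    · exact not_sameHalfMeander_of_fixed hM hσ hpq hz hfix (hrun ⟨le_rfl, hlt⟩) hmark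
        harc.sameHalfMeander
    · exact not_sameHalfMeander_of_fixed hM hσ hpq hz hfix (hrun (a := k - 1) (by grind)) hmark
        (.refl _)
  · have harc : IsHalfArc (J (!b)) k k := ⟨p', q', hpq', by omega, by omega, by omega⟩
    exact absurd ⟨k, .refl _, _, harc⟩
      (not_halfMeanderIsEdge_of_fixed hM hσ hpq hz hfix (hrun (a := k) (by grind)))

end Fixed

/-- All arcs at `x` leave `x` if `d` is true and enter `x` if `d` is false. -/
def PointsAway (σ : Bool → Equiv.Perm ℕ) (d : Bool) (x : ℕ) : Prop :=
  ∀ c, σ c x ≠ x → Before (c == d) x (σ c x)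

/-- The properties of a pair of modified involutions on which the straightening of an edge depends:
arcs stay inside parts and, in a part of the upper (lower) partition, a source is to the left
(right) of a sink if one of them is a turning point and the other one a turning point or an
end-point. -/
structure RespectsParts {n : ℕ} (J : Bool → Finpartition (Finset.Icc 1 n))
    (σ : Bool → Equiv.Perm ℕ) : Prop where
  connected : ∀ b, IsConnectedPartition (J b)
  samePart : ∀ b x, x ∈ Set.Icc 1 n → SamePart (J b) x (σ b x)
  before : ∀ b d x z, SamePart (J b) x z → x ≠ z → (∀ c, σ c x ≠ x) → (∃ c, σ c z ≠ z) →
    PointsAway σ d x → PointsAway σ (!d) z → Before (b == d) x z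

variable (hJ : ∀ b, IsConnectedPartition (J b)) (hM : IsMarking J M)
  (hσ : ∀ b, IsModifiedInvolution (J b) (M b) (σ b))

include hM hσ

theorem before_of_ne {s : Bool} {x z : ℕ} (hS : SamePart (J b) x z) (hxz : x ≠ z)
    (hx : Before s x (σ b x)) (hz : Before s (σ b z) z) : Before s x z := by
  obtain ⟨p, q, hpq, hxp, hzp⟩ := hS
  have hbx := (hσ b).bounds (hM.isArc b) hpq hxp
  have hbz := (hσ b).bounds (hM.isArc b) hpq hzp
  cases s
  · rw [before_false] at *
    omega
  · rw [before_true] at *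
    omega

include hJ

theorem before_of_fixed {s : Bool} {x z : ℕ} (hS : SamePart (J b) x z) (hxz : x ≠ z)
    (hx : Before s x (σ b x)) (hx' : Before (!s) x (σ (!b) x)) (hz : σ b z = z)
    (hz' : Before (!s) (σ (!b) z) z) : Before s x z := by
  obtain ⟨p, q, hpq, hxp, hzp⟩ := hS
  have hbx := (hσ b).bounds (hM.isArc b) hpq hxp
  obtain ⟨p', q', hpq', hxp'⟩ :=
    exists_part (hJ (!b)) (Finset.mem_Icc.2 (mem_Icc_of_mem_part hpq hxp))
  have hbx' := (hσ (!b)).bounds (hM.isArc _) hpq' hxp'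
  have hbz' := fun h => (hσ (!b)).bounds (hM.isArc _) hpq' (x := z) h
  have hcentre := fun lo hi => exists_centre_fixed hM (hσ b) hpq hzp hz (hσ (!b)) (lo := lo)
    (hi := hi) (hpq' := hpq')
  refine (before_or_before s hxz).resolve_right fun hzx => ?_
  cases s
  · simp only [Bool.not_false, before_true, before_false] at hx hx' hz' hzx
    obtain ⟨y, rfl | rfl, -, hy⟩ := hcentre x z hzx (fun i hi => .inr (by grind)) (by omega)
      (by omega) (by omega) <;> omega
  · simp only [Bool.not_true, before_true, before_false] at hx hx' hz' hzx
    obtain ⟨y, rfl | rfl, -, hy⟩ := hcentre z x hzx (fun i hi => .inl (by grind)) (by omega)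
      (by omega) (by omega) <;> omega

theorem respectsParts_of_isMarking : RespectsParts J σ where
  connected := hJ
  samePart b x hx := by
    obtain ⟨p, q, hpq, hxp⟩ := exists_part (hJ b) (Finset.mem_Icc.2 hx)
    exact ⟨p, q, hpq, hxp, ((hσ b).bounds (hM.isArc b) hpq hxp).1⟩
  before b d x z hS hxz hmx hmz hx hz := by
    have hxb := hx b (hmx b)
    have hxb' := hx (!b) (hmx (!b))
    rw [not_beq] at hxb'
    by_cases hfix : σ b z = z
    · have hz' : σ (!b) z ≠ z := by
        obtain ⟨c, hc⟩ := hmz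
        rcases Bool.eq_or_eq_not c b with rfl | rfl
        · exact absurd hfix hc
        · exact hc
      have hzb := hz (!b) hz'
      rw [beq_not, before_not, not_beq] at hzb
      exact before_of_fixed hJ hM hσ hS hxz hxb hxb' hfix hzb
    · have hzb := hz b hfix
      rw [beq_not, before_not] at hzb
      exact before_of_ne hM hσ hS hxz hxb hzb

end Ordering

/-! ### The enumeration of an edge -/

section Enumeration

theorem eq_and_eq_of_root_eq {x y r s : ℕ} (hxy : x ≠ y) (h : root x y = root r s) :
    x = r ∧ y = s := by
  have h1 := congrFun h x
  have h2 := congrFun h y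
  simp only [root_apply, hxy, hxy.symm, if_true, if_false] at h1 h2
  split_ifs at h1 h2 <;> omega

theorem root_mem_rootsS_iff {σ : Bool → Equiv.Perm ℕ} {x y : ℕ} (hxy : x ≠ y) :
    root x y ∈ rootsS σ ↔ ∃ c, σ c x = y ∧ Before c x y := by
  constructor
  · rintro (⟨i, hi, h⟩ | ⟨i, hi, h⟩)
    · obtain ⟨rfl, rfl⟩ := eq_and_eq_of_root_eq hxy h
      exact ⟨true, rfl, hi⟩
    · obtain ⟨rfl, rfl⟩ := eq_and_eq_of_root_eq hxy h
      exact ⟨false, rfl, hi⟩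
  · rintro ⟨c, rfl, h⟩
    cases c
    · exact Or.inr ⟨x, h, rfl⟩
    · exact Or.inl ⟨x, h, rfl⟩

theorem IsMeander.apply_mem {σ : Bool → Equiv.Perm ℕ} {E : Set ℕ}
    (hE : IsMeander (σ true) (σ false) E) (c : Bool) {x : ℕ} (hx : x ∈ E) : σ c x ∈ E := by
  obtain ⟨y, rfl⟩ := hE
  have hc : σ c ∈ Subgroup.closure {σ true, σ false} :=
    Subgroup.subset_closure (by cases c <;> simp)
  exact MulAction.mem_orbit_of_mem_orbit (⟨σ c, hc⟩ : Subgroup.closure {σ true, σ false}) hx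

theorem IsMeander.subset_of_fixed_compl {σ : Bool → Equiv.Perm ℕ} {E X : Set ℕ}
    (hE : IsMeander (σ true) (σ false) E) (hnt : E.Nontrivial) (hinv : ∀ b x, σ b (σ b x) = x)
    (hX : ∀ b, ∀ x ∉ X, σ b x = x) : E ⊆ X := by
  obtain ⟨x, rfl⟩ := hE
  have hsub : ∀ {Y : Set ℕ}, (∀ b, ∀ y ∈ Y, σ b y ∈ Y) → x ∈ Y →
      MulAction.orbit (Subgroup.closure {σ true, σ false}) x ⊆ Y := fun hY =>
    orbit_closure_subset (Equiv.ext (hinv true)) (Equiv.ext (hinv false)) (hY true) (hY false)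
  by_cases hx : x ∈ X
  · refine hsub (fun b y hy => ?_) hx
    by_contra hc
    have hfix := hX b _ hc
    rw [hinv] at hfix
    exact hc (hfix ▸ hy)
  · have hsingle := hsub (Y := {x}) (by rintro b y rfl; exact hX b y hx) rfl
    exact absurd (Set.subsingleton_singleton.anti hsingle) (Set.not_subsingleton_iff.2 hnt)

theorem exists_injOn_of_finite {α : Type*} {f : ℕ → α} {s : Set α} (hs : s.Finite)
    (hf : ∀ t, 1 ≤ t → f t ∈ s) :
    ∃ T, 1 ≤ T ∧ Set.InjOn f (Set.Icc 1 T) ∧ f (T + 1) ∈ f '' Set.Icc 1 T := by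
  by_contra! h
  have hinj : ∀ T, 1 ≤ T → Set.InjOn f (Set.Icc 1 T) := by
    intro T hT
    induction T, hT using Nat.le_induction with
    | base => simp
    | succ T hT ih =>
      rw [← Set.insert_Icc_right_eq_Icc_add_one (by omega), Set.injOn_insert (by simp)]
      exact ⟨ih, h T hT ih⟩
  have hsub : f '' Set.Icc 1 (s.ncard + 1) ⊆ s := Set.image_subset_iff.2 fun t ht => hf t ht.1
  have hle := Set.ncard_le_ncard hsub hs
  rw [(hinj _ (by omega)).ncard_image, ← Finset.coe_Icc, Set.ncard_coe_finset, Nat.card_Icc] at hle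
  omega

variable {σ : Bool → Equiv.Perm ℕ} {a : ℕ}

theorem stepSide_succ (t : ℕ) : stepSide σ a (t + 1) = !stepSide σ a t := by
  unfold stepSide
  simp only [Nat.odd_add_one]
  by_cases h1 : σ true a = a <;> by_cases h2 : Odd t <;> simp [h1, h2]

theorem phi_succ {t : ℕ} (ht : 1 ≤ t) : phi σ a (t + 1) = σ (stepSide σ a t) (phi σ a t) := by
  obtain ⟨k, rfl⟩ := Nat.exists_eq_add_of_le' ht
  rfl

theorem sigma_not_stepSide_one (hfix : σ true a = a ∨ σ false a = a) :
    σ (!stepSide σ a 1) a = a := by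
  unfold stepSide
  by_cases h : σ true a = a
  · simp [h]
  · simpa [h] using hfix.resolve_left h

section Involutive

variable (hinv : ∀ b x, σ b (σ b x) = x)

include hinv

theorem sigma_stepSide_phi_succ {t : ℕ} (ht : 1 ≤ t) :
    σ (stepSide σ a t) (phi σ a (t + 1)) = phi σ a t := by
  rw [phi_succ ht, hinv]

variable (hstart : σ (!stepSide σ a 1) a = a)

include hstart

/-- For `t = 1` this uses the junk value `phi σ a 0 = a`. -/
theorem sigma_not_stepSide_phi {t : ℕ} (ht : 1 ≤ t) :
    σ (!stepSide σ a t) (phi σ a t) = phi σ a (t - 1) := by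
  rcases ht.eq_or_lt with rfl | h
  · exact hstart
  · obtain ⟨k, rfl⟩ := Nat.exists_eq_add_of_le' h.le
    rw [stepSide_succ, Bool.not_not]
    exact sigma_stepSide_phi_succ hinv (by omega)

theorem phi_succ_eq_self {T : ℕ} (hT : 1 ≤ T) (hinj : Set.InjOn (phi σ a) (Set.Icc 1 T))
    (hmem : phi σ a (T + 1) ∈ phi σ a '' Set.Icc 1 T) : phi σ a (T + 1) = phi σ a T := by
  obtain ⟨j, ⟨hj1, hjT⟩, hj⟩ := hmem
  rcases hjT.eq_or_lt with rfl | hlt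
  · exact hj.symm
  exfalso
  have hTj : σ (stepSide σ a T) (phi σ a j) = phi σ a T := by
    rw [hj, sigma_stepSide_phi_succ hinv hT]
  rcases Bool.eq_or_eq_not (stepSide σ a T) (stepSide σ a j) with hs | hs
  · rw [hs, ← phi_succ hj1] at hTj
    obtain rfl := hinj ⟨by omega, hlt⟩ ⟨hT, le_rfl⟩ hTj
    rw [stepSide_succ] at hs
    exact Bool.not_ne_self _ hs
  · rw [hs, sigma_not_stepSide_phi hinv hstart hj1] at hTj
    rcases hj1.eq_or_lt with rfl | hj1
    · exact hlt.ne (hinj ⟨le_rfl, hT⟩ ⟨hT, le_rfl⟩ hTj)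
    · have := hinj (x₁ := j - 1) ⟨by omega, by omega⟩ ⟨hT, le_rfl⟩ hTj
      omega

theorem sigma_mem_image_phi {T : ℕ} (hend : phi σ a (T + 1) = phi σ a T) (c : Bool) :
    ∀ x ∈ phi σ a '' Set.Icc 1 T, σ c x ∈ phi σ a '' Set.Icc 1 T := by
  rintro _ ⟨t, ⟨ht1, htT⟩, rfl⟩
  rcases Bool.eq_or_eq_not c (stepSide σ a t) with rfl | rfl
  · rw [← phi_succ ht1]
    rcases htT.eq_or_lt with rfl | h
    · exact ⟨t, ⟨ht1, le_rfl⟩, hend.symm⟩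
    · exact ⟨t + 1, ⟨by omega, h⟩, rfl⟩
  · rw [sigma_not_stepSide_phi hinv hstart ht1]
    rcases ht1.eq_or_lt with rfl | h
    · exact ⟨1, ⟨le_rfl, htT⟩, rfl⟩
    · exact ⟨t - 1, ⟨by omega, by omega⟩, rfl⟩

end Involutive

/-- `φ(1), …, φ(e)` is an enumeration of the edge `E` from one fixed end-point to the other. -/
structure IsEnumeration (σ : Bool → Equiv.Perm ℕ) (a e : ℕ) (E : Set ℕ) : Prop where
  involutive : ∀ b x, σ b (σ b x) = x
  start : σ (!stepSide σ a 1) a = a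
  fixed_end : phi σ a (e + 1) = phi σ a e
  injOn : Set.InjOn (phi σ a) (Set.Icc 1 e)
  image_eq : phi σ a '' Set.Icc 1 e = E
  one_lt : 1 < e

theorem isEnumeration_of_isMeander (hinv : ∀ b x, σ b (σ b x) = x) {E : Set ℕ}
    (hE : IsMeander (σ true) (σ false) E) (hfin : E.Finite) (hnt : E.Nontrivial) (ha : a ∈ E)
    (hfix : σ true a = a ∨ σ false a = a) : IsEnumeration σ a E.ncard E := by
  have hstart := sigma_not_stepSide_one hfix
  have hmem : ∀ t, 1 ≤ t → phi σ a t ∈ E := by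
    intro t ht
    induction t, ht using Nat.le_induction with
    | base => exact ha
    | succ t ht ih => rw [phi_succ ht]; exact hE.apply_mem _ ih
  obtain ⟨T, hT, hinj, hrep⟩ := exists_injOn_of_finite hfin hmem
  have hend := phi_succ_eq_self hinv hstart hT hinj hrep
  have himg : phi σ a '' Set.Icc 1 T = E := by
    refine (Set.image_subset_iff.2 fun t ht => hmem t ht.1).antisymm ?_
    have hst := sigma_mem_image_phi hinv hstart hend
    obtain ⟨y, rfl⟩ := hE
    rw [← MulAction.orbit_eq_iff.2 ha]
    exact orbit_closure_subset (Equiv.ext (hinv true)) (Equiv.ext (hinv false)) (hst true)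
      (hst false) ⟨1, ⟨le_rfl, hT⟩, rfl⟩
  have hcard : E.ncard = T := by
    rw [← himg, hinj.ncard_image, ← Finset.coe_Icc, Set.ncard_coe_finset, Nat.card_Icc,
      Nat.add_sub_cancel]
  have hlt := (Set.one_lt_ncard_iff_nontrivial_and_finite).2 ⟨hnt, hfin⟩
  rw [hcard] at hlt ⊢
  exact ⟨hinv, hstart, hend, hinj, himg, hlt⟩

open Classical in
/-- The direction of the arrow of the `i`-th arc of an edge: it is true if the arrow points from
`φ(i)` to `φ(i + 1)`. -/
noncomputable def arrow (σ : Bool → Equiv.Perm ℕ) (a i : ℕ) : Bool :=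
  decide (Before (stepSide σ a i) (phi σ a i) (phi σ a (i + 1)))

/-- The root joining the points of an edge with the indices `p.1` and `p.2`. -/
def rootAt (σ : Bool → Equiv.Perm ℕ) (a : ℕ) (p : ℕ × ℕ) : ℕ → ℤ :=
  root (phi σ a p.1) (phi σ a p.2)

theorem arrow_eq_true_iff {i : ℕ} :
    arrow σ a i = true ↔ Before (stepSide σ a i) (phi σ a i) (phi σ a (i + 1)) := by
  simp [arrow]

namespace IsEnumeration

variable {e : ℕ} {E : Set ℕ} (h : IsEnumeration σ a e E)

include h

theorem phi_ne {i j : ℕ} (hi : 1 ≤ i ∧ i ≤ e) (hj : 1 ≤ j ∧ j ≤ e) (hij : i ≠ j) :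
    phi σ a i ≠ phi σ a j :=
  fun heq => hij (h.injOn hi hj heq)

theorem phi_ne_succ {i : ℕ} (hi : i ∈ Set.Ico 1 e) : phi σ a i ≠ phi σ a (i + 1) :=
  h.phi_ne ⟨hi.1, hi.2.le⟩ ⟨i.succ_pos, hi.2⟩ i.lt_succ_self.ne

theorem phi_mem {i : ℕ} (hi : 1 ≤ i ∧ i ≤ e) : phi σ a i ∈ E :=
  h.image_eq ▸ Set.mem_image_of_mem _ hi

theorem before_arrow {i : ℕ} (hi : i ∈ Set.Ico 1 e) :
    Before (stepSide σ a i == arrow σ a i) (phi σ a i) (phi σ a (i + 1)) := by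
  by_cases hb : Before (stepSide σ a i) (phi σ a i) (phi σ a (i + 1))
  · rwa [arrow_eq_true_iff.2 hb, beq_true]
  · rw [Bool.eq_false_of_not_eq_true (mt arrow_eq_true_iff.1 hb), beq_false, before_not]
    exact (before_or_before _ (h.phi_ne_succ hi)).resolve_left hb

theorem sigma_phi {k : ℕ} (hk : 1 ≤ k ∧ k ≤ e) (c : Bool) :
    (c = stepSide σ a k ∧ k < e ∧ σ c (phi σ a k) = phi σ a (k + 1)) ∨
      (c = stepSide σ a (k - 1) ∧ 1 < k ∧ σ c (phi σ a k) = phi σ a (k - 1)) ∨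
      σ c (phi σ a k) = phi σ a k := by
  rcases Bool.eq_or_eq_not c (stepSide σ a k) with rfl | rfl
  · rw [← phi_succ hk.1]
    rcases hk.2.eq_or_lt with rfl | hlt
    · exact .inr (.inr h.fixed_end)
    · exact .inl ⟨rfl, hlt, rfl⟩
  · rw [sigma_not_stepSide_phi h.involutive h.start hk.1]
    rcases hk.1.eq_or_lt with rfl | hlt
    · exact .inr (.inr rfl)
    · obtain ⟨k, rfl⟩ := Nat.exists_eq_add_of_le' hk.1
      exact .inr (.inl ⟨by rw [stepSide_succ, Bool.not_not, Nat.add_sub_cancel], hlt, rfl⟩)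

theorem beta_mem_rootsS_iff {i : ℕ} (hi : i ∈ Set.Ico 1 e) :
    beta σ a i ∈ rootsS σ ↔ arrow σ a i = true := by
  have hne := h.phi_ne_succ hi
  rw [beta, root_mem_rootsS_iff hne, arrow_eq_true_iff]
  constructor
  · rintro ⟨c, hc, hb⟩
    rcases h.sigma_phi ⟨hi.1, hi.2.le⟩ c with ⟨rfl, -, -⟩ | ⟨-, h2, h3⟩ | h3
    · exact hb
    · have := hi.2
      exact absurd (h3.symm.trans hc) (h.phi_ne (by omega) (by omega) (by omega))
    · exact absurd (h3.symm.trans hc) hne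
  · exact fun hb => ⟨_, (phi_succ hi.1).symm, hb⟩

theorem eps_eq {i : ℕ} (hi : i ∈ Set.Ico 1 e) : eps σ a i = if arrow σ a i then 1 else -1 := by
  simp only [eps, h.beta_mem_rootsS_iff hi]

theorem eps_smul_rootAt {i : ℕ} (hi : i ∈ Set.Ico 1 e) (p : ℕ × ℕ) :
    eps σ a i • rootAt σ a p = rootAt σ a (orient (arrow σ a i) p) := by
  rw [h.eps_eq hi]
  cases arrow σ a i <;> simp [orient, rootAt, neg_root]

theorem eps_smul_beta {i : ℕ} (hi : i ∈ Set.Ico 1 e) :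
    eps σ a i • beta σ a i = rootAt σ a (oldArc (arrow σ a) i) :=
  h.eps_smul_rootAt hi (i, i + 1)

theorem rootAt_oldArc_mem_rootsSOn {i : ℕ} (hi : i ∈ Set.Ico 1 e) :
    rootAt σ a (oldArc (arrow σ a) i) ∈ rootsSOn σ E := by
  have hne := h.phi_ne_succ hi
  have hm := h.phi_mem ⟨hi.1, hi.2.le⟩
  have hm' := h.phi_mem ⟨i.succ_pos, hi.2⟩
  have hb := h.before_arrow hi
  cases hd : arrow σ a i
  · rw [hd, beq_false, before_not] at hb
    rw [oldArc, hd]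
    exact ⟨(root_mem_rootsS_iff hne.symm).2 ⟨_, sigma_stepSide_phi_succ h.involutive hi.1, hb⟩,
      _, hm', _, hm, hne.symm, rfl⟩
  · rw [hd, beq_true] at hb
    rw [oldArc, hd]
    exact ⟨(root_mem_rootsS_iff hne).2 ⟨_, (phi_succ hi.1).symm, hb⟩, _, hm, _, hm', hne, rfl⟩

theorem rootsSOn_eq : rootsSOn σ E = (fun i => eps σ a i • beta σ a i) '' Set.Ico 1 e := by
  apply Set.Subset.antisymm
  · rintro _ ⟨hS, u, hu, v, hv, huv, rfl⟩
    obtain ⟨c, rfl, hb⟩ := (root_mem_rootsS_iff huv).1 hS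
    rw [← h.image_eq] at hu
    obtain ⟨k, hk, rfl⟩ := hu
    rcases h.sigma_phi hk c with ⟨rfl, hke, heq⟩ | ⟨hc, hk1, heq⟩ | heq
    · rw [heq] at hb ⊢
      refine ⟨k, ⟨hk.1, hke⟩, (h.eps_smul_beta ⟨hk.1, hke⟩).trans ?_⟩
      rw [oldArc, arrow_eq_true_iff.2 hb]
      rfl
    · obtain ⟨j, rfl⟩ := Nat.exists_eq_add_of_le' hk.1
      have hj : j ∈ Set.Ico 1 e := ⟨by omega, hk.2⟩
      rw [Nat.add_sub_cancel] at hc heq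
      rw [heq, hc] at hb
      refine ⟨j, hj, (h.eps_smul_beta hj).trans ?_⟩
      rw [oldArc, Bool.eq_false_of_not_eq_true (mt arrow_eq_true_iff.1 hb.asymm), heq]
      rfl
    · exact absurd heq.symm huv
  · rintro _ ⟨i, hi, rfl⟩
    simpa only [h.eps_smul_beta hi] using h.rootAt_oldArc_mem_rootsSOn hi

end IsEnumeration

end Enumeration

/-! ### Turning points of an edge -/

section TurningPoints

variable {e : ℕ} {d : ℕ → Bool}

theorem exists_hasType_gt {t : ℕ} (ht : t ∈ Set.Ico 1 e) : ∃ s > t, HasType e d (!d t) s := by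
  by_cases hd : t + 1 < e ∧ d (t + 1) = d t
  · obtain ⟨s, hs, hty⟩ := exists_hasType_gt (t := t + 1) ⟨by omega, hd.1⟩
    exact ⟨s, by omega, hd.2 ▸ hty⟩
  · exact ⟨t + 1, t.lt_succ_self, by omega, ht.2,
      fun h => Bool.eq_not.2 fun h' => hd ⟨h, h'⟩, fun _ => by simp⟩
termination_by e - t

theorem eq_of_isLeast_hasType {c t : ℕ}
    (hc : IsLeast {s | t < s ∧ HasType e d (!d t) s} c) {k : ℕ} (hk : k ∈ Set.Ico t c) :
    d k = d t := by
  obtain ⟨htk, hkc⟩ := hk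
  induction k, htk using Nat.le_induction with
  | base => rfl
  | succ k htk ih =>
    by_contra hne
    have hce := hc.1.2.2.1
    exact hkc.not_ge (hc.2 ⟨by omega, by omega, by omega, fun _ => Bool.eq_not.2 hne,
      fun _ => by simpa using ih (by omega)⟩)

theorem exists_hasType_le {m : ℕ} (hm : m ∈ Set.Ico 1 e) :
    ∃ s ≤ m, HasType e d (d m) s ∧ ∀ r ≤ m, d r ≠ d m → r < s := by
  by_cases hd : 1 < m ∧ d (m - 1) = d m
  · obtain ⟨s, hs, hty, hlast⟩ := exists_hasType_le (m := m - 1) (by grind)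
    rw [hd.2] at hty hlast
    refine ⟨s, by omega, hty, fun r hr hne => hlast r ?_ hne⟩
    have : r ≠ m := by rintro rfl; exact hne rfl
    omega
  · refine ⟨m, le_rfl, ⟨hm.1, hm.2.le, fun _ => rfl, fun h => Bool.eq_not.2 fun h' => hd ⟨h, h'⟩⟩,
      fun r hr hne => lt_of_le_of_ne hr ?_⟩
    rintro rfl
    exact hne rfl
termination_by m

theorem exists_lt_mem_beyond {t : ℕ} (ht : Turns e d t) (N : ℕ → Prop) :
    ∃ s < t, s ∈ beyond e d N t (!d t) := by
  have h1 := ht.1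
  have h2 := ht.2.1
  obtain ⟨s, hs, hty, hlast⟩ := exists_hasType_le (e := e) (d := d) (m := t - 1) (by grind)
  rw [ht.hasType.2.2.2 h1] at hty hlast
  refine ⟨s, by omega, hty, fun r hr _ _ hd => hlast r (by omega) ?_⟩
  simpa using hd

theorem HasType.eq {b : Bool} {t : ℕ} (h : HasType e d b t) (ht : t < e) : d t = b :=
  h.2.2.1 ht

theorem intervalValue_eq {σ : Bool → Equiv.Perm ℕ} {a s t : ℕ} (hst : s ≤ t) :
    intervalValue σ a s t = root (phi σ a s) (phi σ a t) := by
  unfold intervalValue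
  induction t, hst using Nat.le_induction with
  | base => simp [root]
  | succ t hst ih => rw [Finset.sum_Ico_succ_top hst, ih, beta, root_add_root]

theorem crossedNeg_eq (σ : Bool → Equiv.Perm ℕ) (a e : ℕ) (sg : ℕ → ℤ) (t : ℕ) :
    crossedNeg σ a e sg t =
      sInf {s | (∀ r ∈ negativeAbove σ a e sg t, r < s) ∧ OppositeType σ a e s t} := by
  unfold crossedNeg
  split_ifs with hne
  · have hfin : (negativeAbove σ a e sg t).Finite := (Set.finite_Iio t).subset fun r hr => hr.1
    simp only [hfin.csSup_lt_iff hne]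
  · simp [Set.not_nonempty_iff_eq_empty.1 hne]

namespace IsEnumeration

variable {σ : Bool → Equiv.Perm ℕ} {a : ℕ} {E : Set ℕ} {sg : ℕ → ℤ}
  (h : IsEnumeration σ a e E)

include h

theorem isInternalTurning_iff (t : ℕ) :
    IsInternalTurning σ a e t ↔ Turns e (arrow σ a) t := by
  refine and_congr_right fun h1 => and_congr_right fun h2 => ?_
  obtain ⟨k, rfl⟩ := Nat.exists_eq_add_of_lt h1
  have hb := h.before_arrow (i := 1 + k) ⟨by omega, by omega⟩
  have hb' := h.before_arrow (i := 1 + k + 1) ⟨by omega, h2⟩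
  rw [stepSide_succ] at hb'
  rw [Nat.add_sub_cancel]
  generalize stepSide σ a (1 + k) = b at *
  generalize arrow σ a (1 + k) = x at *
  generalize arrow σ a (1 + k + 1) = y at *
  cases b <;> cases x <;> cases y <;> simp [Before] at hb hb' ⊢ <;> omega

theorem eps_eq_iff {i : ℕ} (hi : i ∈ Set.Ico 1 e) (b : Bool) :
    eps σ a i = (if b then 1 else -1) ↔ arrow σ a i = b := by
  rw [h.eps_eq hi]
  cases arrow σ a i <;> cases b <;> simp

theorem isTurning_of_hasType {b : Bool} {t : ℕ} (ht : HasType e (arrow σ a) b t) :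
    IsTurning σ a e t := by
  obtain ⟨h1, h2, h3, h4⟩ := ht
  rcases h1.eq_or_lt with rfl | h1
  · exact .inl rfl
  rcases h2.eq_or_lt with rfl | h2
  · exact .inr (.inl rfl)
  refine .inr (.inr ((h.isInternalTurning_iff t).2 ⟨h1, h2, ?_⟩))
  rw [h3 h2, h4 h1]
  exact Bool.not_ne_self b

theorem mem_Icc_of_isTurning {t : ℕ} (ht : IsTurning σ a e t) : 1 ≤ t ∧ t ≤ e := by
  have := h.one_lt
  rcases ht with rfl | rfl | ht
  · omega
  · omega
  · exact ⟨ht.1.le, ht.2.1.le⟩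

theorem hasType_iff (b : Bool) (t : ℕ) :
    HasType e (arrow σ a) b t ↔ IsTurning σ a e t ∧
      (t < e → eps σ a t = if b then 1 else -1) ∧
      (1 < t → eps σ a (t - 1) = if !b then 1 else -1) := by
  have hbounds : 1 ≤ t ∧ t ≤ e →
      ((t < e → arrow σ a t = b) ↔ (t < e → eps σ a t = if b then 1 else -1)) ∧
      ((1 < t → arrow σ a (t - 1) = !b) ↔ (1 < t → eps σ a (t - 1) = if !b then 1 else -1)) :=
    fun ht => ⟨forall_congr' fun _ => (h.eps_eq_iff ⟨by omega, by omega⟩ _).symm,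
      forall_congr' fun _ => (h.eps_eq_iff ⟨by omega, by omega⟩ _).symm⟩
  constructor
  · intro ht
    obtain ⟨h1, h2⟩ := hbounds ⟨ht.1, ht.2.1⟩
    exact ⟨h.isTurning_of_hasType ht, h1.1 ht.2.2.1, h2.1 ht.2.2.2⟩
  · rintro ⟨ht, h3, h4⟩
    have hb := h.mem_Icc_of_isTurning ht
    obtain ⟨h1, h2⟩ := hbounds hb
    exact ⟨hb.1, hb.2, h1.2 h3, h2.2 h4⟩

theorem isSource_iff (t : ℕ) : IsSource σ a e t ↔ HasType e (arrow σ a) true t :=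
  (h.hasType_iff true t).symm

theorem isSink_iff (t : ℕ) : IsSink σ a e t ↔ HasType e (arrow σ a) false t :=
  (h.hasType_iff false t).symm

theorem oppositeType_iff {t : ℕ} (ht : Turns e (arrow σ a) t) (s : ℕ) :
    OppositeType σ a e s t ↔ HasType e (arrow σ a) (!arrow σ a t) s := by
  unfold OppositeType
  rw [h.isSource_iff, h.isSource_iff, h.isSink_iff, h.isSink_iff]
  constructor
  · rintro (⟨hs, ht'⟩ | ⟨hs, ht'⟩) <;> rwa [ht'.eq ht.2.1]
  · have hty := ht.hasType
    intro hs
    cases hd : arrow σ a t <;> rw [hd] at hs hty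
    · exact .inl ⟨hs, hty⟩
    · exact .inr ⟨hs, hty⟩

theorem sameType_iff {r t : ℕ} (hr : Turns e (arrow σ a) r) (ht : Turns e (arrow σ a) t) :
    SameType σ a e r t ↔ arrow σ a r = arrow σ a t := by
  unfold SameType
  rw [h.isSource_iff, h.isSource_iff, h.isSink_iff, h.isSink_iff]
  constructor
  · rintro (⟨hr', ht'⟩ | ⟨hr', ht'⟩) <;> rw [hr'.eq hr.2.1, ht'.eq ht.2.1]
  · have htr := hr.hasType
    have htt := ht.hasType
    intro heq
    cases hd : arrow σ a t <;> rw [heq, hd] at htr <;> rw [hd] at htt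
    · exact .inr ⟨htr, htt⟩
    · exact .inl ⟨htr, htt⟩

theorem isLeast_crossedPos {t : ℕ} (ht : Turns e (arrow σ a) t) :
    IsLeast {s | t < s ∧ HasType e (arrow σ a) (!arrow σ a t) s} (crossedPos σ a e t) := by
  simp only [crossedPos, h.oppositeType_iff ht]
  exact ⟨Nat.sInf_mem (exists_hasType_gt ⟨ht.1.le, ht.2.1⟩), fun s hs => Nat.sInf_le hs⟩

theorem crossedNeg_eq_sInf_beyond {t : ℕ} (ht : Turns e (arrow σ a) t) :
    crossedNeg σ a e sg t = sInf (beyond e (arrow σ a) (fun r => sg r = -1) t (!arrow σ a t)) := by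
  rw [crossedNeg_eq]
  congr 1
  ext s
  simp only [Set.mem_ofPred_eq, beyond, h.oppositeType_iff ht, negativeAbove,
    h.isInternalTurning_iff, Bool.not_not]
  rw [and_comm]
  refine and_congr_right fun _ => ⟨fun hs r hr htr hN hd => ?_, fun hs r hr => ?_⟩
  · exact hs r ⟨hr, htr, (h.sameType_iff htr ht).2 hd, hN⟩
  · exact hs r hr.1 hr.2.1 hr.2.2.2 ((h.sameType_iff hr.2.1 ht).1 hr.2.2.1)

theorem isLeast_crossedNeg {t : ℕ} (ht : Turns e (arrow σ a) t) :
    IsLeast (beyond e (arrow σ a) (fun r => sg r = -1) t (!arrow σ a t))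
      (crossedNeg σ a e sg t) := by
  rw [h.crossedNeg_eq_sInf_beyond ht]
  obtain ⟨s, -, hs⟩ := exists_lt_mem_beyond ht fun r => sg r = -1
  exact ⟨Nat.sInf_mem ⟨s, hs⟩, fun s hs => Nat.sInf_le hs⟩

theorem crossedNeg_lt {t : ℕ} (ht : Turns e (arrow σ a) t) : crossedNeg σ a e sg t < t := by
  obtain ⟨s, hst, hs⟩ := exists_lt_mem_beyond ht fun r => sg r = -1
  exact ((h.isLeast_crossedNeg ht).2 hs).trans_lt hst

theorem betaStar_eq (hsign : ∀ t, IsInternalTurning σ a e t → sg t = 1 ∨ sg t = -1) {i : ℕ}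
    (hi : i ∈ Set.Ico 1 e) :
    betaStar σ a e sg i = rootAt σ a (newArc e (arrow σ a) (fun t => sg t = -1)
      (crossedNeg σ a e sg) (crossedPos σ a e) i) := by
  have hpos : (Turns e (arrow σ a) (i + 1) ∧ sg (i + 1) = 1) ↔
      Turns e (arrow σ a) (i + 1) ∧ ¬ sg (i + 1) = -1 := by
    refine and_congr_right fun ht => ?_
    have := hsign _ ((h.isInternalTurning_iff _).2 ht)
    omega
  rw [betaStar, newArc, h.isInternalTurning_iff, h.isInternalTurning_iff]
  split_ifs with hneg h1 h2 h2
  · rw [intervalValue_eq (h.crossedNeg_lt hneg.1).le, beta, add_comm, root_add_root]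
    exact h.eps_smul_rootAt hi (_, _)
  · rw [intervalValue_eq (h.isLeast_crossedPos h1.1).1.1.le, beta, root_add_root]
    exact h.eps_smul_rootAt hi (_, _)
  · exact absurd (hpos.1 h1) h2
  · exact absurd (hpos.2 h2) h1
  · exact h.eps_smul_beta hi

theorem pointsAway_of_hasType {b : Bool} {t : ℕ} (ht : HasType e (arrow σ a) b t) :
    PointsAway σ b (phi σ a t) := by
  intro c hne
  rcases h.sigma_phi ⟨ht.1, ht.2.1⟩ c with ⟨rfl, hte, heq⟩ | ⟨rfl, ht1, heq⟩ | heq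
  · rw [heq, ← ht.eq hte]
    exact h.before_arrow ⟨ht.1, hte⟩
  · obtain ⟨k, rfl⟩ := Nat.exists_eq_add_of_le' ht.1
    rw [heq, Nat.add_sub_cancel]
    have hd := ht.2.2.2 ht1
    have hb := h.before_arrow (i := k) ⟨by omega, by have := ht.2.1; omega⟩
    rw [Nat.add_sub_cancel] at hd
    rwa [hd, beq_not, before_not] at hb
  · exact absurd heq hne

theorem sigma_stepSide_ne {t : ℕ} (ht : t ∈ Set.Ico 1 e) :
    σ (stepSide σ a t) (phi σ a t) ≠ phi σ a t := by
  rw [← phi_succ ht.1]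
  exact (h.phi_ne_succ ht).symm

theorem sigma_not_stepSide_ne {t : ℕ} (ht : 1 < t ∧ t ≤ e) :
    σ (!stepSide σ a t) (phi σ a t) ≠ phi σ a t := by
  rw [sigma_not_stepSide_phi h.involutive h.start ht.1.le]
  exact h.phi_ne (by omega) (by omega) (by omega)

theorem sigma_ne_of_turns {t : ℕ} (ht : Turns e (arrow σ a) t) (c : Bool) :
    σ c (phi σ a t) ≠ phi σ a t := by
  rcases Bool.eq_or_eq_not c (stepSide σ a t) with rfl | rfl
  · exact h.sigma_stepSide_ne ⟨ht.1.le, ht.2.1⟩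
  · exact h.sigma_not_stepSide_ne ⟨ht.1, ht.2.1.le⟩

theorem exists_sigma_ne {t : ℕ} (ht : 1 ≤ t ∧ t ≤ e) : ∃ c, σ c (phi σ a t) ≠ phi σ a t := by
  rcases ht.2.eq_or_lt with rfl | hlt
  · exact ⟨_, h.sigma_not_stepSide_ne ⟨h.one_lt, le_rfl⟩⟩
  · exact ⟨_, h.sigma_stepSide_ne ⟨ht.1, hlt⟩⟩

end IsEnumeration

end TurningPoints

/-! ### The straightened edge -/

section StraightenedEdge

namespace IsEnumeration

variable {n : ℕ} {J : Bool → Finpartition (Finset.Icc 1 n)} {σ : Bool → Equiv.Perm ℕ} {a e : ℕ}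
  {E : Set ℕ} {sg : ℕ → ℤ} (h : IsEnumeration σ a e E) (hR : RespectsParts J σ)
  (hEn : E ⊆ Set.Icc 1 n)

section

include h hR

theorem before_of_samePart {b : Bool} {t s : ℕ} (ht : Turns e (arrow σ a) t)
    (hs : HasType e (arrow σ a) (!arrow σ a t) s)
    (hS : SamePart (J b) (phi σ a t) (phi σ a s)) :
    Before (b == arrow σ a t) (phi σ a t) (phi σ a s) := by
  have hst : t ≠ s := by
    rintro rfl
    exact Bool.not_ne_self _ (hs.eq ht.2.1).symm
  exact hR.before b _ _ _ hS (h.phi_ne ⟨ht.1.le, ht.2.1.le⟩ ⟨hs.1, hs.2.1⟩ hst)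
    (h.sigma_ne_of_turns ht) (h.exists_sigma_ne ⟨hs.1, hs.2.1⟩)
    (h.pointsAway_of_hasType ht.hasType) (h.pointsAway_of_hasType hs)

include hEn

theorem samePart_stepSide {k : ℕ} (hk : k ∈ Set.Ico 1 e) :
    SamePart (J (stepSide σ a k)) (phi σ a k) (phi σ a (k + 1)) := by
  rw [phi_succ hk.1]
  exact hR.samePart _ _ (hEn (h.phi_mem ⟨hk.1, hk.2.le⟩))

theorem isNil_beta_iff {k : ℕ} (hk : k ∈ Set.Ico 1 e) :
    IsNil J (beta σ a k) ↔ ¬ SamePart (J !stepSide σ a k) (phi σ a k) (phi σ a (k + 1)) := by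
  rw [beta, isNil_root_iff hR.connected (hEn (h.phi_mem ⟨hk.1, hk.2.le⟩))
    (hEn (h.phi_mem ⟨k.succ_pos, hk.2⟩)) (h.phi_ne_succ hk)]
  refine ⟨fun ⟨c, hc⟩ => ?_, fun hc => ⟨_, hc⟩⟩
  rcases Bool.eq_or_eq_not c (stepSide σ a k) with rfl | rfl
  · exact absurd (h.samePart_stepSide hR hEn hk) hc
  · exact hc

theorem isNil_beta_of_turns {t : ℕ} (ht : Turns e (arrow σ a) t)
    (ht' : Turns e (arrow σ a) (t + 1)) : IsNil J (beta σ a t) := by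
  have hi : t ∈ Set.Ico 1 e := ⟨ht.1.le, ht.2.1⟩
  rw [h.isNil_beta_iff hR hEn hi]
  intro hS
  have hty := ht'.hasType
  rw [ht'.eq_not] at hty
  have hb := h.before_of_samePart hR ht hty hS
  rw [not_beq, before_not] at hb
  exact hb.asymm (h.before_arrow hi)

/-- An arc which continues in the same direction does not bring an edge back into a part that it has
left. -/
theorem before_phi_succ {b : Bool} {x k : ℕ} (hk : k ∈ Set.Ico 1 e)
    (hx : Before (b == arrow σ a k) (phi σ a k) x) (hS : ¬ SamePart (J b) x (phi σ a k)) :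
    Before (b == arrow σ a k) (phi σ a (k + 1)) x ∧ ¬ SamePart (J b) x (phi σ a (k + 1)) := by
  rcases Bool.eq_or_eq_not (stepSide σ a k) b with hs | hs
  · have hSk := h.samePart_stepSide hR hEn hk
    rw [hs] at hSk
    have hS' : ¬ SamePart (J b) x (phi σ a (k + 1)) := fun hS' => hS (hS'.trans hSk.symm)
    have hne : phi σ a (k + 1) ≠ x := by
      rintro rfl
      exact hS hSk.symm
    exact ⟨(before_or_before _ hne).resolve_right fun hb => hS (hSk.of_between hx hb).symm, hS'⟩
  · have hb := h.before_arrow hk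
    rw [hs, not_beq] at hb
    exact ⟨(before_not.1 hb).trans hx, fun hS' => hS (hS'.of_between (before_not.2 hx) hb)⟩

theorem before_crossedPos {t : ℕ} (ht : Turns e (arrow σ a) t) (hnil : IsNil J (beta σ a t)) :
    Before ((!stepSide σ a t) == arrow σ a t) (phi σ a (crossedPos σ a e t)) (phi σ a t) := by
  have hi : t ∈ Set.Ico 1 e := ⟨ht.1.le, ht.2.1⟩
  have hc := h.isLeast_crossedPos ht
  have hce := hc.1.2.2.1
  suffices key : ∀ k, t + 1 ≤ k → k ≤ crossedPos σ a e t →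
      Before ((!stepSide σ a t) == arrow σ a t) (phi σ a k) (phi σ a t) ∧
        ¬ SamePart (J !stepSide σ a t) (phi σ a t) (phi σ a k) from (key _ hc.1.1 le_rfl).1
  intro k hk
  induction k, hk using Nat.le_induction with
  | base =>
    refine fun _ => ⟨?_, (h.isNil_beta_iff hR hEn hi).1 hnil⟩
    rw [not_beq, before_not]
    exact h.before_arrow hi
  | succ k hk ih =>
    intro hkc
    obtain ⟨hb, hS⟩ := ih (by omega)
    have hd : arrow σ a k = arrow σ a t := eq_of_isLeast_hasType hc ⟨by omega, hkc⟩
    rw [← hd] at hb ⊢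
    exact h.before_phi_succ hR hEn ⟨by omega, by omega⟩ hb hS

theorem rootAt_orient_mem_rootsK_iff {s k : ℕ} (hs : 1 ≤ s ∧ s ≤ e) (hk : 1 ≤ k ∧ k ≤ e)
    (hsk : s ≠ k) (d : Bool) :
    rootAt σ a (orient d (s, k)) ∈ rootsK J ↔
      ∀ c, Before (c == d) (phi σ a s) (phi σ a k) →
        ¬ SamePart (J c) (phi σ a s) (phi σ a k) := by
  have hsn := hEn (h.phi_mem hs)
  have hkn := hEn (h.phi_mem hk)
  have hne := h.phi_ne hs hk hsk
  cases d
  · refine (root_mem_rootsK_iff hR.connected hkn hsn hne.symm).trans (forall_congr' fun c => ?_)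
    rw [beq_false, before_not, samePart_comm]
  · refine (root_mem_rootsK_iff hR.connected hsn hkn hne).trans (forall_congr' fun c => ?_)
    rw [beq_true]

/-- Here `φ(s)` has the type opposite to the turning point `φ(t)`, and `φ(k)` is the neighbour of
`φ(t)` on the side `b`. -/
theorem rootAt_mem_rootsK {t s k : ℕ} (ht : Turns e (arrow σ a) t)
    (hs : HasType e (arrow σ a) (!arrow σ a t) s) (hk : 1 ≤ k ∧ k ≤ e) (hsk : s ≠ k) {b : Bool}
    (hb : phi σ a k = σ b (phi σ a t))
    (hpath : ¬ SamePart (J !b) (phi σ a t) (phi σ a k) →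
      ¬ Before (b == arrow σ a t) (phi σ a t) (phi σ a s)) :
    rootAt σ a (orient (arrow σ a t) (s, k)) ∈ rootsK J := by
  have hSb : SamePart (J b) (phi σ a t) (phi σ a k) :=
    hb ▸ hR.samePart b _ (hEn (h.phi_mem ⟨ht.1.le, ht.2.1.le⟩))
  have htk : Before (b == arrow σ a t) (phi σ a t) (phi σ a k) :=
    hb ▸ h.pointsAway_of_hasType ht.hasType b (h.sigma_ne_of_turns ht b)
  have hapart : Before (b == arrow σ a t) (phi σ a t) (phi σ a s) →
      ¬ SamePart (J !b) (phi σ a t) (phi σ a s) := by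
    intro hts hS
    have hts' := h.before_of_samePart hR ht hs hS
    rw [not_beq, before_not] at hts'
    exact hts'.asymm hts
  refine (h.rootAt_orient_mem_rootsK_iff hR hEn ⟨hs.1, hs.2.1⟩ hk hsk _).2 fun c hc hSc => ?_
  rcases Bool.eq_or_eq_not c b with rfl | rfl
  · have hts := h.before_of_samePart hR ht hs (hSb.trans hSc.symm)
    exact hpath (fun hS => hapart hts (hS.of_between hts hc)) hts
  · rw [not_beq, before_not] at hc
    have hts := htk.trans hc
    exact hpath (fun hS => hapart hts (hS.trans hSc.symm)) hts

end

section Signature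

variable (hsg : IsSignature J σ a e sg)

include h hsg

theorem not_isNil_of_neg {t : ℕ} (ht : Turns e (arrow σ a) t) (hN : sg t = -1) :
    ¬ IsNil J (beta σ a t) := by
  intro hnil
  have ht' := (h.isInternalTurning_iff t).2 ht
  have hpos : sg t = 1 := by
    by_cases hprev : IsNil J (beta σ a (t - 1))
    · exact hsg.both t ht' hprev hnil
    · exact hsg.lower t ht' hprev hnil
  omega

include hR hEn

theorem isCrossing : IsCrossing e (arrow σ a) (fun t => sg t = -1) (crossedNeg σ a e sg)
    (crossedPos σ a e) where
  neg _ ht _ := h.isLeast_crossedNeg ht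
  pos _ ht _ := h.isLeast_crossedPos ht
  succ _ ht hN ht' :=
    absurd (h.isNil_beta_of_turns hR hEn ht ht') (h.not_isNil_of_neg hsg ht hN)

theorem rootAt_crossedNeg_mem_rootsK {t : ℕ} (ht : Turns e (arrow σ a) t) (hN : sg t = -1) :
    rootAt σ a (orient (arrow σ a t) (crossedNeg σ a e sg t, t + 1)) ∈ rootsK J := by
  have hi : t ∈ Set.Ico 1 e := ⟨ht.1.le, ht.2.1⟩
  have hlt := h.crossedNeg_lt (sg := sg) ht
  refine h.rootAt_mem_rootsK hR hEn ht (h.isLeast_crossedNeg ht).1.1 ⟨t.succ_pos, hi.2⟩ (by omega)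
    (phi_succ hi.1) fun hS => ?_
  exact absurd ((h.isNil_beta_iff hR hEn hi).2 hS) (h.not_isNil_of_neg hsg ht hN)

theorem rootAt_crossedPos_mem_rootsK {i : ℕ} (hi : 1 ≤ i) (ht : Turns e (arrow σ a) (i + 1))
    (hN : sg (i + 1) ≠ -1) :
    rootAt σ a (orient (arrow σ a i) (i, crossedPos σ a e (i + 1))) ∈ rootsK J := by
  have hie : i < e := i.lt_succ_self.trans ht.2.1
  have hgt := (h.isLeast_crossedPos ht).1.1
  have hd : arrow σ a i = !arrow σ a (i + 1) := by rw [ht.eq_not, Bool.not_not]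
  rw [hd, orient_not_mk]
  refine h.rootAt_mem_rootsK hR hEn ht (h.isLeast_crossedPos ht).1.2 ⟨hi, hie.le⟩ (by omega)
    (sigma_stepSide_phi_succ h.involutive hi).symm fun hS => ?_
  have hnil : IsNil J (beta σ a i) := by
    rwa [h.isNil_beta_iff hR hEn ⟨hi, hie⟩, samePart_comm]
  have hnil' : IsNil J (beta σ a (i + 1)) := by
    by_contra hnot
    exact hN (hsg.upper (i + 1) ((h.isInternalTurning_iff _).2 ht) hnil hnot)
  have hb := h.before_crossedPos hR hEn ht hnil'
  rw [stepSide_succ, Bool.not_not] at hb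
  exact hb.asymm

theorem betaStar_mem_rootsK {i : ℕ} (hi : i ∈ Set.Ico 1 e)
    (hne : betaStar σ a e sg i ≠ eps σ a i • beta σ a i) : betaStar σ a e sg i ∈ rootsK J := by
  rw [h.betaStar_eq hsg.sign hi] at hne ⊢
  unfold newArc at hne ⊢
  split_ifs at hne ⊢ with hneg hpos
  · exact h.rootAt_crossedNeg_mem_rootsK hR hEn hsg hneg.1 hneg.2
  · exact h.rootAt_crossedPos_mem_rootsK hR hEn hsg hi.1 hpos.1 hpos.2
  · exact absurd (h.eps_smul_beta hi).symm hne

theorem exists_list_linkRoots_eq : ∃ L : List ℕ, L.Nodup ∧ {x | x ∈ L} = E ∧ L.length = e ∧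
    linkRoots L = PiStar σ a e sg ∧
      ∀ i ∈ Set.Ico 1 e, eps σ a i • beta σ a i ∈ natSpan (linkRoots L) := by
  obtain ⟨L, hperm, hlinks, hordered⟩ :=
    exists_list_links_eq h.one_lt (h.isCrossing hR hEn hsg)
  have hmem : ∀ x, x ∈ L ↔ x ∈ Set.Icc 1 e := fun x => by
    rw [hperm.mem_iff, List.mem_range'_1, Set.mem_Icc]
    omega
  have hnodup : L.Nodup := hperm.nodup_iff.2 List.nodup_range'
  refine ⟨L.map (phi σ a), hnodup.map_on fun x hx y hy => h.injOn ((hmem x).1 hx) ((hmem y).1 hy),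
    ?_, ?_, ?_, fun i hi => ?_⟩
  · rw [← h.image_eq]
    ext x
    simp only [List.mem_map, hmem, Set.mem_ofPred_eq, Set.mem_image]
  · rw [List.length_map, hperm.length_eq, List.length_range']
  · rw [linkRoots, links_map, hlinks, PiStar, Set.image_image, Set.image_image]
    exact Set.image_congr fun i hi => (h.betaStar_eq hsg.sign hi).symm
  · rw [h.eps_smul_beta hi]
    exact root_mem_natSpan_linkRoots ((hordered i hi).map (phi σ a))

end Signature

end IsEnumeration

end StraightenedEdge

end Straightening

theorem proposition6p7_general (n : ℕ)
    (J : Bool → Finpartition (Finset.Icc 1 n))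
    (hJ : ∀ b, IsConnectedPartition (J b))
    (M : Bool → Set ℕ) (hM : IsMarking J M)
    (σ : Bool → Equiv.Perm ℕ) (hσ : ∀ b, IsModifiedInvolution (J b) (M b) (σ b))
    (E : Set ℕ) (hE : IsEdge (σ true) (σ false) E) (hnt : E.Nontrivial)
    (a : ℕ) (ha : a ∈ E) (hfix : σ true a = a ∨ σ false a = a)
    (sg : ℕ → ℤ) (hsg : IsSignature J σ a E.ncard sg) :
    IsSimpleSystem (rootsOn E) (PiStar σ a E.ncard sg) ∧
    IsOfTypeA n (E.ncard - 1) (PiStar σ a E.ncard sg) ∧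
    (fun i => eps σ a i • beta σ a i) '' Set.Ico 1 E.ncard = rootsSOn σ E ∧
    (∀ i ∈ Set.Ico 1 E.ncard, eps σ a i • beta σ a i ∈ natSpan (PiStar σ a E.ncard sg)) ∧
    (∀ i ∈ Set.Ico 1 E.ncard, betaStar σ a E.ncard sg i ≠ eps σ a i • beta σ a i →
      betaStar σ a E.ncard sg i ∈ rootsK J) := by
  have hinv := fun b => (hσ b).involutive
  have hEn : E ⊆ Set.Icc 1 n :=
    hE.1.subset_of_fixed_compl hnt hinv fun b => (hσ b).outside
  have h : IsEnumeration σ a E.ncard E :=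
    isEnumeration_of_isMeander hinv hE.1 ((Set.finite_Icc 1 n).subset hEn) hnt ha hfix
  have hR : RespectsParts J σ := respectsParts_of_isMarking hJ hM hσ
  obtain ⟨L, hnodup, hmem, hlen, hL, hspan⟩ := h.exists_list_linkRoots_eq hR hEn hsg
  have hsimple := isSimpleSystem_linkRoots hnodup
  have htype := isOfTypeA_linkRoots (n := n) hnodup fun x hx =>
    Finset.mem_Icc.2 (hEn (hmem ▸ hx : x ∈ E))
  rw [hL] at hsimple htype hspan
  rw [hmem] at hsimple
  rw [hlen] at htype
  exact ⟨hsimple, htype, h.rootsSOn_eq.symm, hspan, fun _ => h.betaStar_mem_rootsK hR hEn hsg⟩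

theorem proposition6p7 (n : ℕ) (hn : 1 < n)
    (J : Bool → Finpartition (Finset.Icc 1 n))
    (hJ : ∀ b, IsConnectedPartition (J b))
    (hcup : simpleIndices (J true) ∪ simpleIndices (J false) = Set.Ico 1 n)
    (hcap : simpleIndices (J true) ∩ simpleIndices (J false) ≠ Set.Ico 1 n)
    (M : Bool → Set ℕ) (hM : IsMarking J M)
    (σ : Bool → Equiv.Perm ℕ) (hσ : ∀ b, IsModifiedInvolution (J b) (M b) (σ b))
    (E : Set ℕ) (hE : IsEdge (σ true) (σ false) E) (hnt : E.Nontrivial)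
    (a : ℕ) (ha : a ∈ E) (hfix : σ true a = a ∨ σ false a = a)
    (sg : ℕ → ℤ) (hsg : IsSignature J σ a E.ncard sg) :
    IsSimpleSystem (rootsOn E) (PiStar σ a E.ncard sg) ∧
    IsOfTypeA n (E.ncard - 1) (PiStar σ a E.ncard sg) ∧
    (fun i => eps σ a i • beta σ a i) '' Set.Ico 1 E.ncard = rootsSOn σ E ∧
    (∀ i ∈ Set.Ico 1 E.ncard, eps σ a i • beta σ a i ∈ natSpan (PiStar σ a E.ncard sg)) ∧
    (∀ i ∈ Set.Ico 1 E.ncard, betaStar σ a E.ncard sg i ≠ eps σ a i • beta σ a i →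
      betaStar σ a E.ncard sg i ∈ rootsK J) :=
  proposition6p7_general n J hJ M hM σ hσ E hE hnt a ha hfix sg hsg
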